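/- \textbf{Setting.} A node is a word $n\in\{0,1\}^*$, a branch is $b\in\{0,1\}^\omega$, and $\mu$ is the uniform (fair coin) probability measure on branches. An alternating nonzero automaton on an alphabet $\Sigma$ consists of a finite totally ordered set $Q$ of states with an initial state $q_0$, a partition $Q=Q_E\sqcup Q_A$ into states of Eve and of Adam, a set of local transitions $q\to_a q'$ and split transitions $q\to_a(r_0,r_1)$ ($a\in\Sigma$), and sets $F_\forall,F_1,F_{>0}\subseteq Q$. Given a tree $t:\{0,1\}^*\to\Sigma$, the acceptance game has vertices $(n,q)\in\{0,1\}^*\times Q$ and starts in $(\epsilon,q_0)$; the controller of $q$ chooses a transition with source $q$ and letter $t(n)$; a local transition $q\to q'$ leads to $(n,q')$, a split transition $q\to(r_0,r_1)$ leads to $(n0,r_0)$ or $(n1,r_1)$ with probability $\frac12$ each. Strategies $\sigma$ of Eve and $\tau$ of Adam choose a transition after every finite play (a nonempty finite sequence of vertices) ending in a vertex of the player, and induce a probability measure $\mathbb P^{\sigma,\tau}$ on infinite plays from the initial vertex. A strategy $\sigma$ of Eve is \emph{positional} if $\sigma(\pi)$ depends only on the last vertex $z$ of $\pi$; one then writes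 $\sigma(z)$. It is \emph{positively winning} if for every strategy $\tau$ of Adam and every finite play $\pi$ from the initial vertex consistent with $\sigma$ and $\tau$ whose last state is in $F_{>0}$, the set of infinite plays extending $\pi$ all of whose states after $\pi$ are in $F_{>0}$ has nonzero $\mathbb P^{\sigma,\tau}$-probability. The automaton is assumed to be \begin{itemize} \item complete: every state has at least one transition on every letter; \item normalized: every split transition with source in $F_{>0}$ has at least one of its two targets in $F_{>0}$, every local transition with source in $F_{>0}$ has its target in $F_{>0}$, and $F_1\subseteq F_\forall$; \item without local loop: for no letter $a$ is there a nonempty cycle of local transitions $q\to_a\cdots\to_a q$. \end{itemize} Let $q\equiv r$ mean that $q,r$ lie in the same strongly connected component of the transition graph on $Q$ (with an edge from the source of each transition to each of its targets). The automaton has \emph{limited choice for Adam} if for every $q\in Q_A$ all transitions with source $q$ are local and for every letter $a$ at most one transition $q\to_a q'$ satisfies $q\equiv q'$; local transitions $q\to_aq'$ with $q\equiv q'$ are called \emph{canonical}. A play is \emph{canonical} if Adam plays only canonical transitions in it, and \emph{positive} if all its states are in $F_{>0}$. A vertex $(n,q)$ is \emph{transient} if it has no immediate successor $(n',q')$ in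 the game with $q\equiv q'$. A finite $\sigma$-play is a finite play, starting in some vertex, that is consistent with $\sigma$ and with some strategy of Adam; a vertex is $\sigma$-reachable if some finite $\sigma$-play from the initial vertex ends in it. A set $T$ of nodes is \emph{everywhere thick} if for every $n\in T$ one has $\mu(\{b : n$ is a prefix of $b$, and every prefix of $b$ of length at least $|n|$ belongs to $T\})>0$. Let $\sigma$ be a positional strategy of Eve and let $Z$ be the set of $\sigma$-reachable vertices whose state is in $F_{>0}$. A \emph{positive witness} for $\sigma$ is a pair $(W,E)$ with $W\subseteq Z$ (active vertices) and $E\subseteq\{0,1\}^*\times\{0,1\}$ (positive edges) such that: \begin{itemize} \item[a)] from every $z\in Z$ there is a positive and canonical finite $\sigma$-play (possibly consisting of $z$ alone) starting in $z$ and ending in a vertex of $W$ or in a transient vertex; \item[b)] for every $z=(n,q)\in W$: $(n,0)\in E$ or $(n,1)\in E$; if $q\in Q_E$ and $\sigma(z)$ is a local transition $q\to q'$, then $(n,q')\in W$; if $q\in Q_A$ and $q\to_{t(n)}q'$ is canonical, then $(n,q')\in W$; if $q\in Q_E$ and $\sigma(z)$ is a split transition $q\to(q_0,q_1)$, then $(n,0)\in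 E\Rightarrow(n0,q_0)\in W$ and $(n,1)\in E\Rightarrow(n1,q_1)\in W$; \item[c)] the set of nodes $\{nd : (n,d)\in E\}$ is everywhere thick. \end{itemize} \textbf{Statement.} Consider a complete and normalized alternating nonzero automaton without local loop that has limited choice for Adam, a tree $t$, and a positional strategy $\sigma$ of Eve in the acceptance game of $t$. Then $\sigma$ is positively winning if and only if there exists a positive witness for $\sigma$. -/

import Mathlib

open MeasureTheory ProbabilityTheory
open scoped ENNReal

namespace AltNonzero

/-! ### The infinite binary tree -/

/-- Nodes are finite words over `{0,1}`, with `0 = false` and `1 = true`, read from the root.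
The sons of `n` are `n ++ [false]` and `n ++ [true]`. -/
abbrev Node := List Bool

/-- Infinite branches of the binary tree. -/
abbrev Branch := ℕ → Bool

/-- The prefix of length `k` of a branch. -/
def Branch.pre (b : Branch) (k : ℕ) : Node := (List.range k).map b

/-- The uniform measure on branches: independent fair coin flips. -/
noncomputable def branchMeasure : Measure Branch :=
  Measure.infinitePi fun _ : ℕ => (PMF.uniformOfFintype Bool).toMeasure

/-- The branches that visit `n` and stay in `T` from `n` on. -/
def stayBranches (T : Set Node) (n : Node) : Set Branch :=
  {b | b.pre n.length = n ∧ ∀ k, n.length ≤ k → b.pre k ∈ T}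

/-- Starting from every node of `T` there is nonzero probability to stay in `T`. -/
def EverywhereThick (T : Set Node) : Prop :=
  ∀ n ∈ T, 0 < branchMeasure (stayBranches T n)

/-! ### Automata -/

inductive Player
  | eve
  | adam

/-- What a transition leads to: `loc q'` for a local transition `q →ₐ q'`,
`split r₀ r₁` for a split transition `q →ₐ (r₀, r₁)`. -/
inductive Move (Q : Type*)
  | loc (q' : Q)
  | split (r₀ r₁ : Q)

/-- An alternating nonzero automaton on the alphabet `Alph` with set of states `Q`.
The partition of the states is given by `owner`; `trans q a m` says that there is a transition
with source `q` and letter `a` leading to `m`. -/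
structure Automaton (Alph Q : Type*) where
  order : LinearOrder Q
  init : Q
  owner : Q → Player
  trans : Q → Alph → Move Q → Prop
  Fsure : Set Q
  Falmost : Set Q
  Fpos : Set Q

variable {Alph Q : Type*}

namespace Automaton

/-- (HC): every state has at least one transition on every letter. -/
def Complete (A : Automaton Alph Q) : Prop :=
  ∀ q a, ∃ m, A.trans q a m

/-- (N1), (N2) and (N3). -/
structure Normalized (A : Automaton Alph Q) : Prop where
  split_pos : ∀ q a r₀ r₁, q ∈ A.Fpos → A.trans q a (.split r₀ r₁) → r₀ ∈ A.Fpos ∨ r₁ ∈ A.Fpos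
  loc_pos : ∀ q a q', q ∈ A.Fpos → A.trans q a (.loc q') → q' ∈ A.Fpos
  almost_sub_sure : A.Falmost ⊆ A.Fsure

/-- (NLL): there is no nonempty cycle of local transitions on a single letter. -/
def NoLocalLoop (A : Automaton Alph Q) : Prop :=
  ∀ a q, ¬ Relation.TransGen (fun r r' => A.trans r a (.loc r')) q q

/-- Edges of the transition graph. -/
def Edge (A : Automaton Alph Q) (q r : Q) : Prop :=
  ∃ a, A.trans q a (.loc r) ∨ ∃ q', A.trans q a (.split r q') ∨ A.trans q a (.split q' r)

/-- Two states are equivalent if they are in the same (strongly) connected component of the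
transition graph. -/
def Equivalent (A : Automaton Alph Q) (q r : Q) : Prop :=
  Relation.ReflTransGen A.Edge q r ∧ Relation.ReflTransGen A.Edge r q

/-- The local transition `q →ₐ q'` exists and is canonical. -/
def CanonicalTrans (A : Automaton Alph Q) (q : Q) (a : Alph) (q' : Q) : Prop :=
  A.trans q a (.loc q') ∧ A.Equivalent q q'

/-- Limited choice for Adam. -/
def LimitedChoice (A : Automaton Alph Q) : Prop :=
  ∀ q, A.owner q = .adam →
    (∀ a r₀ r₁, ¬ A.trans q a (.split r₀ r₁)) ∧
    ∀ a q' q'', A.CanonicalTrans q a q' → A.CanonicalTrans q a q'' → q' = q''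

end Automaton

/-! ### The acceptance game -/

/-- Vertices of the acceptance game. -/
structure Vertex (Q : Type*) where
  node : Node
  state : Q

instance [Countable Q] : Countable (Vertex Q) :=
  Function.Injective.countable (f := fun v : Vertex Q => (v.node, v.state)) (by
    rintro ⟨n, q⟩ ⟨n', q'⟩ h
    simpa using h)

instance : MeasurableSpace (Vertex Q) := ⊤

instance : DiscreteMeasurableSpace (Vertex Q) := ⟨fun _ => trivial⟩

/-- Finite plays with `k` steps: sequences of `k + 1` vertices, indexed by `0, …, k`. -/
abbrev FinPlay (Q : Type*) (k : ℕ) := (i : Finset.Iic k) → Vertex Q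

namespace FinPlay

/-- The `i`-th vertex. -/
def at' {k : ℕ} (π : FinPlay Q k) (i : ℕ) (h : i ≤ k) : Vertex Q :=
  π ⟨i, Finset.mem_Iic.2 h⟩

def first {k : ℕ} (π : FinPlay Q k) : Vertex Q := π.at' 0 (Nat.zero_le k)

def last {k : ℕ} (π : FinPlay Q k) : Vertex Q := π.at' k le_rfl

/-- The prefix of a finite play consisting of its first `i` steps. -/
def pre {k : ℕ} (π : FinPlay Q k) (i : ℕ) (h : i ≤ k) : FinPlay Q i :=
  Preorder.frestrictLe₂ (π := fun _ => Vertex Q) h π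

/-- The play consisting of a single vertex. -/
def single (v : Vertex Q) : FinPlay Q 0 := fun _ => v

end FinPlay

/-- `m.Leads n v`: playing the move `m` at the node `n` may lead to the vertex `v`. -/
def Move.Leads : Move Q → Node → Vertex Q → Prop
  | .loc q', n, v => v = ⟨n, q'⟩
  | .split r₀ r₁, n, v => v = ⟨n ++ [false], r₀⟩ ∨ v = ⟨n ++ [true], r₁⟩

/-- The distribution of the next vertex when the move `m` is played at the node `n`. -/
noncomputable def Move.law : Move Q → Node → Measure (Vertex Q)
  | .loc q', n => Measure.dirac ⟨n, q'⟩
  | .split r₀ r₁, n =>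
      (2⁻¹ : ℝ≥0∞) • Measure.dirac ⟨n ++ [false], r₀⟩ +
        (2⁻¹ : ℝ≥0∞) • Measure.dirac ⟨n ++ [true], r₁⟩

instance (m : Move Q) (n : Node) : IsProbabilityMeasure (m.law n) := by
  cases m with
  | loc q' => exact inferInstanceAs (IsProbabilityMeasure (Measure.dirac _))
  | split r₀ r₁ => exact ⟨by simp [Move.law, ENNReal.inv_two_add_inv_two]⟩

/-- A strategy of the player `p` in the acceptance game of the tree `t`: it chooses, after every
finite play whose last vertex is controlled by `p`, a transition available there. -/
abbrev Strategy (A : Automaton Alph Q) (t : Node → Alph) (p : Player) :=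
  ∀ (k : ℕ) (π : FinPlay Q k), A.owner π.last.state = p →
    {m : Move Q // A.trans π.last.state (t π.last.node) m}

variable {A : Automaton Alph Q} {t : Node → Alph}

/-- The transition chosen after `π` by the player who controls the last vertex. -/
def choice (σ : Strategy A t .eve) (τ : Strategy A t .adam) {k : ℕ} (π : FinPlay Q k) : Move Q :=
  match h : A.owner π.last.state with
  | .eve => (σ k π h).1
  | .adam => (τ k π h).1

/-- The transition kernels of the non-homogeneous Markov chain induced by `σ` and `τ`. -/
noncomputable def stepKernel [Countable Q] (σ : Strategy A t .eve) (τ : Strategy A t .adam)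
    (k : ℕ) : Kernel (FinPlay Q k) (Vertex Q) :=
  Kernel.ofFunOfCountable fun π => (choice σ τ π).law π.last.node

instance [Countable Q] (σ : Strategy A t .eve) (τ : Strategy A t .adam) (k : ℕ) :
    IsMarkovKernel (stepKernel σ τ k) :=
  ⟨fun π => inferInstanceAs (IsProbabilityMeasure ((choice σ τ π).law π.last.node))⟩

/-- The initial vertex of the acceptance game. -/
def initVertex (A : Automaton Alph Q) : Vertex Q := ⟨[], A.init⟩

/-- The probability measure on infinite plays induced by `σ` and `τ` (Ionescu-Tulcea), for the
game started in the initial vertex. -/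
noncomputable def playMeasure [Countable Q] (σ : Strategy A t .eve) (τ : Strategy A t .adam) :
    Measure (ℕ → Vertex Q) :=
  Kernel.traj (X := fun _ => Vertex Q) (stepKernel σ τ) 0 (FinPlay.single (initVertex A))

/-- Every step of `π` may occur when the transitions are chosen by `σ` and `τ`. -/
def Follows (σ : Strategy A t .eve) (τ : Strategy A t .adam) {k : ℕ} (π : FinPlay Q k) : Prop :=
  ∀ (i : ℕ) (hi : i < k),
    (choice σ τ (π.pre i hi.le)).Leads (π.at' i hi.le).node (π.at' (i + 1) hi)

/-- `π` is a finite play of the game, from the initial vertex, consistent with `σ` and `τ`. -/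
def Consistent (σ : Strategy A t .eve) (τ : Strategy A t .adam) {k : ℕ} (π : FinPlay Q k) : Prop :=
  π.first = initVertex A ∧ Follows σ τ π

/-- The infinite plays that extend `π` and only visit states in `F_{>0}` after `π`. -/
def positiveContinuations (A : Automaton Alph Q) {k : ℕ} (π : FinPlay Q k) :
    Set (ℕ → Vertex Q) :=
  {ω | (∀ (i : ℕ) (h : i ≤ k), ω i = π.at' i h) ∧ ∀ i, k < i → (ω i).state ∈ A.Fpos}

/-- The strategy `σ` of Eve is positively winning: it satisfies the positive winning condition
against every strategy of Adam. -/
def PositivelyWinning [Countable Q] (σ : Strategy A t .eve) : Prop :=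
  ∀ (τ : Strategy A t .adam) (k : ℕ) (π : FinPlay Q k), Consistent σ τ π →
    π.last.state ∈ A.Fpos → 0 < playMeasure σ τ (positiveContinuations A π)

/-- A strategy of Eve is positional if it only depends on the last vertex. -/
def Positional (σ : Strategy A t .eve) : Prop :=
  ∀ (k k' : ℕ) (π : FinPlay Q k) (π' : FinPlay Q k') (h : A.owner π.last.state = .eve)
    (h' : A.owner π'.last.state = .eve), π.last = π'.last → (σ k π h).1 = (σ k' π' h').1

/-- The transition `σ(z)` chosen by a positional strategy at a vertex `z` of Eve. -/
def moveAt (σ : Strategy A t .eve) (z : Vertex Q) (h : A.owner z.state = .eve) : Move Q :=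
  (σ 0 (FinPlay.single z) h).1

/-! ### Positive witnesses -/

/-- `π` is a finite `σ`-play, started in its first vertex (which need not be initial). -/
def IsSigmaPlay (σ : Strategy A t .eve) {k : ℕ} (π : FinPlay Q k) : Prop :=
  ∃ τ : Strategy A t .adam, Follows σ τ π

/-- `v` is reachable from the initial vertex by a finite `σ`-play. -/
def Reachable (σ : Strategy A t .eve) (v : Vertex Q) : Prop :=
  ∃ (k : ℕ) (π : FinPlay Q k), π.first = initVertex A ∧ IsSigmaPlay σ π ∧ π.last = v

/-- `z → z'` is a canonical (local) transition of the game. -/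
def CanonicalStep (A : Automaton Alph Q) (t : Node → Alph) (z z' : Vertex Q) : Prop :=
  z'.node = z.node ∧ A.CanonicalTrans z.state (t z.node) z'.state

/-- Adam only plays canonical transitions in `π`. -/
def CanonicalPlay (A : Automaton Alph Q) (t : Node → Alph) {k : ℕ} (π : FinPlay Q k) : Prop :=
  ∀ (i : ℕ) (hi : i < k), A.owner (π.at' i hi.le).state = .adam →
    CanonicalStep A t (π.at' i hi.le) (π.at' (i + 1) hi)

/-- All states visited by `π` are in `F_{>0}`. -/
def PositivePlay (A : Automaton Alph Q) {k : ℕ} (π : FinPlay Q k) : Prop :=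
  ∀ (i : ℕ) (hi : i ≤ k), (π.at' i hi).state ∈ A.Fpos

/-- A vertex is transient if none of its immediate successors in the acceptance game has a state
equivalent to its own. -/
def TransientVertex (A : Automaton Alph Q) (t : Node → Alph) (z : Vertex Q) : Prop :=
  ∀ (m : Move Q) (z' : Vertex Q), A.trans z.state (t z.node) m → m.Leads z.node z' →
    ¬ A.Equivalent z.state z'.state

/-- `(W, E)` is a positive witness for the (positional) strategy `σ`. -/
structure PositiveWitness (σ : Strategy A t .eve) (W : Set (Vertex Q)) (E : Set (Node × Bool)) :
    Prop where
  active : ∀ z ∈ W, Reachable σ z ∧ z.state ∈ A.Fpos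
  /-- Condition a). -/
  reach : ∀ z : Vertex Q, Reachable σ z → z.state ∈ A.Fpos →
    ∃ (k : ℕ) (π : FinPlay Q k), π.first = z ∧ IsSigmaPlay σ π ∧ PositivePlay A π ∧
      CanonicalPlay A t π ∧ (π.last ∈ W ∨ TransientVertex A t π.last)
  /-- Condition b), existence of a positive edge. -/
  edge : ∀ z ∈ W, (z.node, false) ∈ E ∨ (z.node, true) ∈ E
  /-- Condition b), local transitions of Eve. -/
  eve_loc : ∀ z ∈ W, ∀ (h : A.owner z.state = .eve) (q' : Q),
    moveAt σ z h = .loc q' → ⟨z.node, q'⟩ ∈ W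
  /-- Condition b), canonical transitions of Adam. -/
  adam_loc : ∀ z ∈ W, A.owner z.state = .adam → ∀ z', CanonicalStep A t z z' → z' ∈ W
  /-- Condition b), split transitions of Eve. -/
  eve_split : ∀ z ∈ W, ∀ (h : A.owner z.state = .eve) (q₀ q₁ : Q),
    moveAt σ z h = .split q₀ q₁ →
      ((z.node, false) ∈ E → ⟨z.node ++ [false], q₀⟩ ∈ W) ∧
      ((z.node, true) ∈ E → ⟨z.node ++ [true], q₁⟩ ∈ W)
  /-- Condition c). -/
  thick : EverywhereThick {n | ∃ e ∈ E, n = e.1 ++ [e.2]}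

end AltNonzero

/-! A branch carries one coin per level of the tree, and it resolves every split along the play.
Against fixed strategies the play is therefore a function `run` of the branch, and
`playMeasure_eq_map_run` identifies its law with the image of the uniform measure. Positive winning
then says that certain sets of branches have positive measure.

A witness suffices by induction down the strongly connected components
(`PositiveWitness.positiveBranches_pos`). If some positive continuation leaves the component, the
induction hypothesis applies to it. Otherwise Adam's moves on positive continuations are all
canonical, hence forced, so the play given by condition a) can be followed against any strategy. It
cannot end in a transient vertex, because normalization would give a positive successor outside the
component. It thus ends in an active vertex, where thickness provides the required branches.

Conversely, let Adam play canonically whenever he can. For each positive reachable vertex from which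
positive play never meets a transient vertex, the branches on which this play stays positive form a
closed set of positive measure. The difficulty is that one set of edges must serve countably many
overlapping closed sets: edges added for one set could lead outside another. `exists_thick_edges`
resolves this with pairwise disjoint trees, each carried by a closed set that is generic: it meets
each target set in a null set or lies inside it on some cone. -/

namespace AltNonzero

/-! ### Cones of the binary tree -/

namespace Branch

@[simp]
theorem length_pre (b : Branch) (k : ℕ) : (b.pre k).length = k := by simp [Branch.pre]

theorem pre_succ (b : Branch) (k : ℕ) : b.pre (k + 1) = b.pre k ++ [b k] := by
  simp [Branch.pre, List.range_succ]

theorem pre_eq_pre_iff {b b' : Branch} {k : ℕ} : b.pre k = b'.pre k ↔ ∀ i < k, b i = b' i := by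
  simp [Branch.pre]

end Branch

/-- The branches that visit `n`. -/
def cone (n : Node) : Set Branch := {b | b.pre n.length = n}

theorem mem_cone {n : Node} {b : Branch} : b ∈ cone n ↔ b.pre n.length = n := Iff.rfl

theorem mem_cone_pre (b : Branch) (k : ℕ) : b ∈ cone (b.pre k) := by simp [cone]

theorem mem_cone_append {n : Node} {d : Bool} {b : Branch} :
    b ∈ cone (n ++ [d]) ↔ b ∈ cone n ∧ b n.length = d := by
  simp only [mem_cone, List.length_append, List.length_singleton, Branch.pre_succ]
  constructor
  · intro h
    simpa using List.append_inj h (by simp)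
  · rintro ⟨h, h'⟩
    rw [h, h']

@[simp]
theorem cone_nil : cone [] = Set.univ := by
  ext b
  simp [mem_cone, Branch.pre]

theorem cone_append_subset (n : Node) (d : Bool) : cone (n ++ [d]) ⊆ cone n :=
  fun _ h => (mem_cone_append.1 h).1

theorem cone_eq_union (n : Node) : cone n = cone (n ++ [false]) ∪ cone (n ++ [true]) := by
  ext b
  cases h : b n.length <;> simp [mem_cone_append, h]

theorem mem_cone_iff_prefix {n : Node} {b : Branch} {k : ℕ} (hk : n.length ≤ k) :
    b ∈ cone n ↔ n <+: b.pre k := by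
  induction k, hk using Nat.le_induction with
  | base =>
    rw [mem_cone]
    exact ⟨fun h => by rw [h], fun h => (h.eq_of_length (by simp)).symm⟩
  | succ k hk ih =>
    rw [Branch.pre_succ, List.prefix_concat_iff, ih]
    refine ⟨Or.inr, fun h => h.resolve_left fun h => ?_⟩
    have := congrArg List.length h
    simp at this
    omega

theorem cone_subset_of_prefix {n m : Node} (h : n <+: m) : cone m ⊆ cone n := by
  intro b hb
  rw [mem_cone_iff_prefix h.length_le, mem_cone.1 hb]
  exact h

theorem prefix_of_mem_cone {n m : Node} {b : Branch} (hn : b ∈ cone n) (hm : b ∈ cone m)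
    (h : n.length ≤ m.length) : n <+: m := by
  rw [← mem_cone.1 hm]
  exact (mem_cone_iff_prefix h).1 hn

/-- A set of branches that is determined by finitely many letters is clopen. -/
theorem isClopen_of_pre {S : Set Branch} {k : ℕ}
    (hS : ∀ b b' : Branch, b.pre k = b'.pre k → b ∈ S → b' ∈ S) : IsClopen S := by
  let r : Branch → (Fin k → Bool) := fun b i => b i
  have hr : Continuous r := by fun_prop
  have : S = r ⁻¹' (r '' S) := by
    refine (Set.subset_preimage_image r S).antisymm ?_
    rintro b' ⟨b, hb, hbb'⟩
    exact hS b b' (Branch.pre_eq_pre_iff.2 fun i hi => congrFun hbb' ⟨i, hi⟩) hb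
  rw [this]
  exact (isClopen_discrete _).preimage hr

theorem isClopen_cone (n : Node) : IsClopen (cone n) :=
  isClopen_of_pre (k := n.length) fun b b' h hb => by rwa [mem_cone, ← h]

theorem measurableSet_cone (n : Node) : MeasurableSet (cone n) :=
  (isClopen_cone n).isClosed.measurableSet

instance : IsProbabilityMeasure branchMeasure := by
  unfold branchMeasure
  infer_instance

theorem branchMeasure_cone (n : Node) : branchMeasure (cone n) = 2⁻¹ ^ n.length := by
  have : cone n = Set.pi (Finset.range n.length) fun i => {n[i]!} := by
    ext b
    simp only [mem_cone, Branch.pre, Set.mem_pi, Finset.coe_range, Set.mem_Iio,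
      Set.mem_singleton_iff]
    constructor
    · intro h i hi
      conv_rhs => rw [← h]
      simp [hi]
    · intro h
      refine List.ext_getElem (by simp) fun i hi hi' => ?_
      simpa [hi'] using h i hi'
  rw [this, branchMeasure, Measure.infinitePi_pi _ (fun _ _ => measurableSet_singleton _)]
  simp

theorem branchMeasure_cone_append (n : Node) (d : Bool) :
    branchMeasure (cone (n ++ [d])) = branchMeasure (cone n) * 2⁻¹ := by
  simp [branchMeasure_cone, pow_succ]

/-- Almost every point of `S` is in the support of the restriction of the measure to `S`. -/
theorem ae_forall_cone_pos (S : Set Branch) :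
    ∀ᵐ b ∂branchMeasure, b ∈ S → ∀ k, 0 < branchMeasure (S ∩ cone (b.pre k)) := by
  -- There are only countably many nodes, so the null sets of the form `S ∩ cone n` can be discarded
  -- together.
  have h : ∀ n : Node, ∀ᵐ b ∂branchMeasure,
      b ∈ S ∩ cone n → 0 < branchMeasure (S ∩ cone n) := by
    intro n
    by_cases h0 : branchMeasure (S ∩ cone n) = 0
    · filter_upwards [measure_eq_zero_iff_ae_notMem.1 h0] with b hb hb'
      exact absurd hb' hb
    · exact Filter.Eventually.of_forall fun _ _ => pos_iff_ne_zero.2 h0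
  filter_upwards [ae_all_iff.2 h] with b hb hS k
  exact hb _ ⟨hS, mem_cone_pre b k⟩

theorem exists_mem_forall_cone_pos {S : Set Branch} (hS : 0 < branchMeasure S) :
    ∃ b ∈ S, ∀ k, 0 < branchMeasure (S ∩ cone (b.pre k)) := by
  by_contra! h
  refine hS.ne' (measure_eq_zero_iff_ae_notMem.2 ?_)
  filter_upwards [ae_forall_cone_pos S] with b hb hbS
  obtain ⟨k, hk⟩ := h b hbS
  exact (hb hbS k).not_ge hk

theorem exists_child_pos {S : Set Branch} {n : Node} (h : 0 < branchMeasure (S ∩ cone n)) :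
    0 < branchMeasure (S ∩ cone (n ++ [false])) ∨ 0 < branchMeasure (S ∩ cone (n ++ [true])) := by
  by_contra! h'
  rw [cone_eq_union, Set.inter_union_distrib_left] at h
  refine h.not_ge ((measure_union_le _ _).trans ?_)
  simp [nonpos_iff_eq_zero.1 h'.1, nonpos_iff_eq_zero.1 h'.2]

/-- Points outside of a closed set have a neighbouring cone outside of it. -/
theorem exists_cone_disjoint {C : Set Branch} (hC : IsClosed C) {b : Branch} (hb : b ∉ C) :
    ∃ k, ∀ j ≥ k, Disjoint C (cone (b.pre j)) := by
  -- A basic neighbourhood of `b` constrains only the coordinates in a finite set `I`; any prefix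
  -- reaching past `I` fixes them.
  obtain ⟨I, u, hu, hsub⟩ := isOpen_pi_iff.1 hC.isOpen_compl b hb
  refine ⟨I.sup id + 1, fun j hj => Set.disjoint_right.2 fun b' hb' => hsub fun i hi => ?_⟩
  have hi' : i < j := (Nat.lt_succ_of_le (Finset.le_sup (f := id) hi)).trans_le hj
  have hb'' : b'.pre j = b.pre j := by simpa [mem_cone] using hb'
  rw [Branch.pre_eq_pre_iff.1 hb'' i hi']
  exact (hu i hi).2

end AltNonzero

namespace AltNonzero

/-! ### Thick sets of edges inside prescribed closed sets -/

/-- A closed set `K` can be shrunk so that some cone, in which it keeps positive measure, has all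
of its points of `K` in `B`, while the measures of `K` in finitely many given cones stay above
given thresholds. -/
theorem exists_shrink {K B : Set Branch} (hK : IsClosed K) (hB : IsClosed B)
    (hKB : 0 < branchMeasure (K ∩ B)) {L : Set (Node × ℝ≥0∞)} (hL : L.Finite)
    (hpos : ∀ p ∈ L, p.2 < branchMeasure (K ∩ cone p.1)) (ℓ : ℕ) :
    ∃ K' ⊆ K, IsClosed K' ∧ (∀ p ∈ L, p.2 < branchMeasure (K' ∩ cone p.1)) ∧
      ∃ n : Node, ℓ ≤ n.length ∧ 0 < branchMeasure (K' ∩ cone n) ∧ K' ∩ cone n ⊆ B := by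
  -- All the finitely many strict inequalities have slack, so they survive the loss of a cone of
  -- depth `N` for `N` large.
  have hN : ∀ᶠ N : ℕ in Filter.atTop,
      ℓ ≤ N ∧ ∀ p ∈ L, p.2 + (2⁻¹ : ℝ≥0∞) ^ N < branchMeasure (K ∩ cone p.1) := by
    refine (Filter.eventually_ge_atTop ℓ).and ((Filter.eventually_all_finite hL).2 fun p hp => ?_)
    have ht : Filter.Tendsto (fun N : ℕ => p.2 + (2⁻¹ : ℝ≥0∞) ^ N) Filter.atTop (nhds (p.2 + 0)) :=
      tendsto_const_nhds.add (ENNReal.tendsto_pow_atTop_nhds_zero_of_lt_one (by simp))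
    rw [add_zero] at ht
    exact ht.eventually_lt_const (hpos p hp)
  obtain ⟨N, hℓ, hN⟩ := hN.exists
  obtain ⟨b, -, hb⟩ := exists_mem_forall_cone_pos hKB
  -- The shrunken set loses only points of the cone of `b.pre N` outside `B`, so no measure drops by
  -- more than `2⁻¹ ^ N`. What remains in that cone has positive measure by the choice of `b`.
  have hcone : (K ∩ ((cone (b.pre N))ᶜ ∪ B)) ∩ cone (b.pre N) = K ∩ B ∩ cone (b.pre N) := by
    ext x
    simp only [Set.mem_inter_iff, Set.mem_union, Set.mem_compl_iff]
    tauto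
  refine ⟨K ∩ ((cone (b.pre N))ᶜ ∪ B), Set.inter_subset_left,
    hK.inter ((isClopen_cone _).compl.isClosed.union hB), fun p hp => ?_,
    b.pre N, by simpa using hℓ, by rw [hcone]; exact hb N, by rw [hcone]; intro x hx; exact hx.1.2⟩
  by_contra! h
  refine (hN p hp).not_ge ?_
  calc branchMeasure (K ∩ cone p.1)
      ≤ branchMeasure ((K ∩ ((cone (b.pre N))ᶜ ∪ B)) ∩ cone p.1 ∪ cone (b.pre N)) := by
        refine measure_mono fun x hx => ?_
        by_cases hx' : x ∈ cone (b.pre N)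
        · exact Or.inr hx'
        · exact Or.inl ⟨⟨hx.1, Or.inl hx'⟩, hx.2⟩
    _ ≤ branchMeasure ((K ∩ ((cone (b.pre N))ᶜ ∪ B)) ∩ cone p.1) + branchMeasure (cone (b.pre N)) :=
        measure_union_le _ _
    _ ≤ p.2 + 2⁻¹ ^ N := by
        rw [branchMeasure_cone, Branch.length_pre]
        gcongr

/-- A closed set of positive measure contains one that either misses a given `B i` up to a
null set or is contained in it inside some cone. -/
theorem exists_closed_generic {B : ℕ → Set Branch} (hB : ∀ i, IsClosed (B i)) (ℓ : ℕ → ℕ)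
    {K₀ : Set Branch} (hK₀ : IsClosed K₀) (hpos : 0 < branchMeasure K₀) :
    ∃ K ⊆ K₀, IsClosed K ∧ 0 < branchMeasure K ∧ ∀ i, branchMeasure (K ∩ B i) = 0 ∨
      ∃ n : Node, ℓ i ≤ n.length ∧ 0 < branchMeasure (K ∩ cone n) ∧ K ∩ cone n ⊆ B i := by
  -- Each pair is a promise: a positive lower bound for the measure in a cone, respected at every
  -- later stage and hence by the final intersection.
  let State := {s : Set Branch × Set (Node × ℝ≥0∞) // IsClosed s.1 ∧ s.2.Finite ∧
    ∀ p ∈ s.2, 0 < p.2 ∧ p.2 < branchMeasure (s.1 ∩ cone p.1)}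
  have hstep : ∀ (i : ℕ) (s : State), ∃ s' : State, s'.1.1 ⊆ s.1.1 ∧ s.1.2 ⊆ s'.1.2 ∧
      (branchMeasure (s'.1.1 ∩ B i) = 0 ∨
        ∃ p ∈ s'.1.2, ℓ i ≤ p.1.length ∧ s'.1.1 ∩ cone p.1 ⊆ B i) := by
    rintro i ⟨⟨K, L⟩, hK, hL, hp⟩
    by_cases h0 : branchMeasure (K ∩ B i) = 0
    · exact ⟨⟨⟨K, L⟩, hK, hL, hp⟩, subset_rfl, subset_rfl, Or.inl h0⟩
    obtain ⟨K', hK'K, hK', hp', n, hn, hn0, hnB⟩ :=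
      exists_shrink hK (hB i) (pos_iff_ne_zero.2 h0) hL (fun p hpL => (hp p hpL).2) (ℓ i)
    -- Half of the current measure leaves the slack that later shrinkings need.
    refine ⟨⟨⟨K', insert (n, branchMeasure (K' ∩ cone n) / 2) L⟩, hK', hL.insert _, ?_⟩, hK'K,
      Set.subset_insert _ _, Or.inr ⟨_, Set.mem_insert _ _, hn, hnB⟩⟩
    rintro p (rfl | hpL)
    · exact ⟨ENNReal.half_pos hn0.ne', ENNReal.half_lt_self hn0.ne' (measure_ne_top _ _)⟩
    · exact ⟨(hp p hpL).1, hp' p hpL⟩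
  choose step hsub hsup hgen using hstep
  -- The promise at the root keeps the intersection itself of positive measure.
  let s₀ : State := ⟨⟨K₀, {([], branchMeasure K₀ / 2)}⟩, hK₀, Set.finite_singleton _, by
    rintro p rfl
    simpa using ⟨hpos.ne', ENNReal.half_lt_self hpos.ne' (measure_ne_top _ _)⟩⟩
  let s : ℕ → State := fun i => Nat.rec s₀ step i
  have hanti : Antitone fun i => (s i).1.1 := antitone_nat_of_succ_le fun i => hsub i (s i)
  have hmono : Monotone fun i => (s i).1.2 := monotone_nat_of_le_succ fun i => hsup i (s i)
  have hlim : ∀ i, ∀ p ∈ (s i).1.2, 0 < branchMeasure ((⋂ j, (s j).1.1) ∩ cone p.1) := by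
    intro i p hp
    refine ((s i).2.2.2 p hp).1.trans_le ?_
    rw [Set.iInter_inter]
    have hanti' : Antitone fun j => (s j).1.1 ∩ cone p.1 := fun j j' h =>
      Set.inter_subset_inter_left _ (hanti h)
    refine ge_of_tendsto (tendsto_measure_iInter_atTop (fun j => ?_) hanti' ⟨0, measure_ne_top _ _⟩)
      (Filter.eventually_atTop.2 ⟨i, fun j hj => ((s j).2.2.2 p (hmono hj hp)).2.le⟩)
    exact ((s j).2.1.measurableSet.inter (measurableSet_cone _)).nullMeasurableSet
  refine ⟨⋂ j, (s j).1.1, Set.iInter_subset _ 0, isClosed_iInter fun j => (s j).2.1, ?_,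
    fun i => ?_⟩
  · simpa using hlim 0 _ rfl
  · rcases hgen i (s i) with h | ⟨p, hp, hℓ, hpB⟩
    · exact Or.inl (measure_mono_null
        (Set.inter_subset_inter_left _ (Set.iInter_subset _ (i + 1))) h)
    · exact Or.inr ⟨p.1, hℓ, hlim (i + 1) p hp,
        (Set.inter_subset_inter_left _ (Set.iInter_subset _ (i + 1))).trans hpB⟩

/-- The node `n` belongs to the tree of the component `p`, consisting of a root and of a set of
branches. -/
def InTree (p : Node × Set Branch) (n : Node) : Prop :=
  p.1 <+: n ∧ 0 < branchMeasure (p.2 ∩ cone n)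

theorem InTree.of_append {p : Node × Set Branch} {n : Node} {d : Bool} (hr : p.1 <+: n)
    (h : InTree p (n ++ [d])) : InTree p n :=
  ⟨hr, h.2.trans_le (measure_mono (Set.inter_subset_inter_right _ (cone_append_subset n d)))⟩

theorem InTree.exists_child {p : Node × Set Branch} {n : Node} (h : InTree p n) :
    InTree p (n ++ [false]) ∨ InTree p (n ++ [true]) :=
  (exists_child_pos h.2).imp (fun h' => ⟨h.1.trans (List.prefix_append _ _), h'⟩)
    (fun h' => ⟨h.1.trans (List.prefix_append _ _), h'⟩)

/-- The edges of a family of trees. -/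
def treeEdges (C : Set (Node × Set Branch)) : Set (Node × Bool) :=
  {e | ∃ p ∈ C, p.1 <+: e.1 ∧ InTree p (e.1 ++ [e.2])}

/-- Almost every branch of the component's set has only prefixes whose cones meet that set in
positive measure, so it never leaves the tree. -/
theorem everywhereThick_treeEdges (C : Set (Node × Set Branch)) :
    EverywhereThick {n | ∃ e ∈ treeEdges C, n = e.1 ++ [e.2]} := by
  rintro _ ⟨⟨n, d⟩, ⟨p, hp, hr, hn⟩, rfl⟩
  refine hn.2.trans_le (measure_mono_ae ?_)
  filter_upwards [ae_forall_cone_pos p.2] with b hb hbn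
  refine ⟨hbn.2, fun k hk => ?_⟩
  simp only [List.length_append, List.length_singleton] at hk
  obtain ⟨j, rfl⟩ : ∃ j, k = j + 1 := ⟨k - 1, by omega⟩
  have hbp : b ∈ cone p.1 := cone_subset_of_prefix hn.1 hbn.2
  have hle : ∀ i, n.length ≤ i → p.1 <+: b.pre i := fun i hi =>
    (mem_cone_iff_prefix (hr.length_le.trans hi)).1 hbp
  refine ⟨(b.pre j, b j), ⟨p, hp, hle j (by omega), ?_⟩, Branch.pre_succ b j⟩
  rw [← Branch.pre_succ]
  exact ⟨hle _ (by omega), hb hbn.1 _⟩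

/-- Finitely many disjoint components can be completed by one more, so that one of them is
contained in `B i` inside some cone. -/
theorem exists_component {B : ℕ → Set Branch} (hB : ∀ i, IsClosed (B i))
    (hpos : ∀ i, 0 < branchMeasure (B i)) (ℓ : ℕ → ℕ) {C : Set (Node × Set Branch)}
    (hfin : C.Finite) (hclosed : ∀ p ∈ C, IsClosed p.2)
    (hgen : ∀ p ∈ C, ∀ i, branchMeasure (p.2 ∩ B i) = 0 ∨
      ∃ n, ℓ i ≤ n.length ∧ InTree p n ∧ p.2 ∩ cone n ⊆ B i)
    (hdisj : ∀ p ∈ C, ∀ p' ∈ C, ∀ n, InTree p n → InTree p' n → p = p') (i : ℕ) :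
    ∃ C', C ⊆ C' ∧ C'.Finite ∧ (∀ p ∈ C', IsClosed p.2) ∧
      (∀ p ∈ C', ∀ i, branchMeasure (p.2 ∩ B i) = 0 ∨
        ∃ n, ℓ i ≤ n.length ∧ InTree p n ∧ p.2 ∩ cone n ⊆ B i) ∧
      (∀ p ∈ C', ∀ p' ∈ C', ∀ n, InTree p n → InTree p' n → p = p') ∧
      ∃ p ∈ C', ∃ n, ℓ i ≤ n.length ∧ InTree p n ∧ p.2 ∩ cone n ⊆ B i := by
  by_cases hex : ∃ p ∈ C, branchMeasure (p.2 ∩ B i) ≠ 0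
  · obtain ⟨p, hp, h⟩ := hex
    exact ⟨C, subset_rfl, hfin, hclosed, hgen, hdisj, p, hp, (hgen p hp i).resolve_left h⟩
  -- No existing component meets `B i` in positive measure. Some point of `B i` then avoids their
  -- finite, hence closed, union, and a new component fits in a cone around it.
  push Not at hex
  have hnull : branchMeasure (⋃ p ∈ C, p.2 ∩ B i) = 0 :=
    (measure_biUnion_null_iff hfin.countable).2 hex
  have hS : 0 < branchMeasure (B i \ ⋃ p ∈ C, p.2 ∩ B i) := by
    rw [measure_sdiff_null hnull]
    exact hpos i
  obtain ⟨b, ⟨hbB, hbC⟩, hb⟩ := exists_mem_forall_cone_pos hS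
  have hbC' : b ∉ ⋃ p ∈ C, p.2 := fun h => hbC (by
    simp only [Set.mem_iUnion] at h ⊢
    obtain ⟨p, hp, hbp⟩ := h
    exact ⟨p, hp, hbp, hbB⟩)
  obtain ⟨N, hN⟩ := exists_cone_disjoint (hfin.isClosed_biUnion hclosed) hbC'
  set r := b.pre N with hr
  have hr0 : 0 < branchMeasure (B i ∩ cone r) :=
    (hb N).trans_le (measure_mono (Set.inter_subset_inter_left _ Set.sdiff_subset))
  -- The bound `r.length` forces the generic nodes to lie below the root `r`.
  obtain ⟨K, hKr, hK, hK0, hKgen⟩ := exists_closed_generic hB (fun j => max (ℓ j) r.length)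
    ((hB i).inter (isClopen_cone r).isClosed) hr0
  have hnew : ∀ p ∈ C, ∀ n, InTree p n → ¬ InTree (r, K) n := by
    intro p hp n h h'
    obtain ⟨x, hx⟩ := nonempty_of_measure_ne_zero h.2.ne'
    exact Set.disjoint_left.1 (hN N le_rfl) (Set.mem_biUnion hp hx.1)
      (cone_subset_of_prefix h'.1 hx.2)
  have hgenr : ∀ j, branchMeasure (K ∩ B j) = 0 ∨
      ∃ n, ℓ j ≤ n.length ∧ InTree (r, K) n ∧ K ∩ cone n ⊆ B j := by
    refine fun j => (hKgen j).imp_right ?_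
    rintro ⟨n, hn, hn0, hnB⟩
    obtain ⟨x, hx⟩ := nonempty_of_measure_ne_zero hn0.ne'
    exact ⟨n, (le_max_left _ _).trans hn,
      ⟨prefix_of_mem_cone (hKr hx.1).2 hx.2 ((le_max_right _ _).trans hn), hn0⟩, hnB⟩
  refine ⟨insert (r, K) C, Set.subset_insert _ _, hfin.insert _, ?_, ?_, ?_,
    (r, K), Set.mem_insert _ _, (hgenr i).resolve_left ?_⟩
  · rintro p (rfl | hp)
    exacts [hK, hclosed p hp]
  · rintro p (rfl | hp)
    exacts [hgenr, hgen p hp]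
  · rintro p (rfl | hp) p' (rfl | hp') n h h'
    exacts [rfl, absurd h (hnew p' hp' n h'), absurd h' (hnew p hp n h), hdisj p hp p' hp' n h h']
  · rw [Set.inter_eq_left.2 fun x hx => (hKr hx).1]
    exact hK0.ne'

/-- Given countably many closed sets of branches of positive measure, there is an everywhere
thick set of edges such that each of the sets has a node from which on all nodes reached by
following these edges have extensions in the set. -/
theorem exists_thick_edges {ι : Type*} [Countable ι] {B : ι → Set Branch}
    (hB : ∀ i, IsClosed (B i)) (hpos : ∀ i, 0 < branchMeasure (B i)) (ℓ : ι → ℕ) :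
    ∃ E : Set (Node × Bool), EverywhereThick {n | ∃ e ∈ E, n = e.1 ++ [e.2]} ∧
      ∀ i, ∃ G : Set Node, G.Nonempty ∧ ∀ n ∈ G, ℓ i ≤ n.length ∧ (B i ∩ cone n).Nonempty ∧
        ((n, false) ∈ E ∨ (n, true) ∈ E) ∧ ∀ d, (n, d) ∈ E → n ++ [d] ∈ G := by
  rcases isEmpty_or_nonempty ι with hι | hι
  · exact ⟨∅, by rintro n ⟨e, he, -⟩; exact he.elim, fun i => hι.elim i⟩
  obtain ⟨f, hf⟩ := exists_surjective_nat ι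
  let State := {C : Set (Node × Set Branch) // C.Finite ∧ (∀ p ∈ C, IsClosed p.2) ∧
    (∀ p ∈ C, ∀ i, branchMeasure (p.2 ∩ B (f i)) = 0 ∨
      ∃ n, ℓ (f i) ≤ n.length ∧ InTree p n ∧ p.2 ∩ cone n ⊆ B (f i)) ∧
    ∀ p ∈ C, ∀ p' ∈ C, ∀ n, InTree p n → InTree p' n → p = p'}
  have hstep : ∀ (i : ℕ) (C : State), ∃ C' : State, C.1 ⊆ C'.1 ∧ ∃ p ∈ C'.1,
      ∃ n, ℓ (f i) ≤ n.length ∧ InTree p n ∧ p.2 ∩ cone n ⊆ B (f i) := by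
    rintro i ⟨C, h1, h2, h3, h4⟩
    obtain ⟨C', hC, h1', h2', h3', h4', h⟩ := exists_component (B := fun i => B (f i))
      (fun _ => hB _) (fun _ => hpos _) (fun i => ℓ (f i)) h1 h2 h3 h4 i
    exact ⟨⟨C', h1', h2', h3', h4'⟩, hC, h⟩
  choose step hsup hgood using hstep
  let s : ℕ → State := fun i => Nat.rec ⟨∅, by simp⟩ step i
  have hmono : Monotone fun i => (s i).1 := monotone_nat_of_le_succ fun i => hsup i (s i)
  have hdisj : ∀ p ∈ ⋃ j, (s j).1, ∀ p' ∈ ⋃ j, (s j).1, ∀ n, InTree p n → InTree p' n → p = p' := by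
    intro p hp p' hp'
    obtain ⟨j, hj⟩ := Set.mem_iUnion.1 hp
    obtain ⟨j', hj'⟩ := Set.mem_iUnion.1 hp'
    exact (s (max j j')).2.2.2.2 p (hmono (le_max_left _ _) hj) p' (hmono (le_max_right _ _) hj')
  refine ⟨treeEdges (⋃ j, (s j).1), everywhereThick_treeEdges _, fun i => ?_⟩
  obtain ⟨i, rfl⟩ := hf i
  obtain ⟨p, hp, n, hℓ, hn, hnB⟩ := hgood i (s i)
  have hpC : p ∈ ⋃ j, (s j).1 := Set.mem_iUnion.2 ⟨i + 1, hp⟩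
  refine ⟨{m | n <+: m ∧ InTree p m}, ⟨n, List.prefix_rfl, hn⟩, ?_⟩
  rintro m ⟨hnm, hm⟩
  refine ⟨hℓ.trans hnm.length_le, ?_, ?_, ?_⟩
  · obtain ⟨x, hx⟩ := nonempty_of_measure_ne_zero hm.2.ne'
    exact ⟨x, hnB ⟨hx.1, cone_subset_of_prefix hnm hx.2⟩, hx.2⟩
  · exact hm.exists_child.imp (fun h => ⟨p, hpC, hm.1, h⟩) (fun h => ⟨p, hpC, hm.1, h⟩)
  -- An edge requires its source to lie below the root of its component. So `m` is in the tree of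
  -- `p'` as well, and disjointness of the trees leaves only `p' = p`.
  · rintro d ⟨p', hp', hr, h⟩
    obtain rfl := hdisj p hpC p' hp' m hm (h.of_append hr)
    exact ⟨hnm.trans (List.prefix_append _ _), h⟩

end AltNonzero

namespace AltNonzero

variable {Alph Q : Type*}

/-! ### Plays driven by branches -/

/-- The vertex reached when the move `m` is played at `n`, a split transition being resolved
by `d`. -/
def Move.next : Move Q → Node → Bool → Vertex Q
  | .loc q', n, _ => ⟨n, q'⟩
  | .split r₀ r₁, n, d => ⟨n ++ [d], bif d then r₁ else r₀⟩

theorem Move.leads_iff {m : Move Q} {n : Node} {v : Vertex Q} :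
    m.Leads n v ↔ ∃ d, v = m.next n d := by
  cases m <;> simp [Move.Leads, Move.next]

/-- Local moves are treated as splits with two equal outcomes, so that later computations need no
case distinction. -/
theorem Move.law_apply_singleton (m : Move Q) (n : Node) (v : Vertex Q) :
    m.law n {v} = 2⁻¹ * ({v} : Set (Vertex Q)).indicator 1 (m.next n false) +
      2⁻¹ * ({v} : Set (Vertex Q)).indicator 1 (m.next n true) := by
  cases m with
  | loc q' => simp [Move.law, Move.next, ← add_mul, ENNReal.inv_two_add_inv_two]
  | split r₀ r₁ => simp [Move.law, Move.next]

theorem Move.next_node (m : Move Q) (n : Node) (d : Bool) :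
    (m.next n d).node = n ∨ (m.next n d).node = n ++ [d] := by
  cases m <;> simp [Move.next]

namespace FinPlay

theorem ext_at {k : ℕ} {π π' : FinPlay Q k} (h : ∀ i hi, π.at' i hi = π'.at' i hi) : π = π' :=
  funext fun i => h i (Finset.mem_Iic.1 i.2)

/-- A finite play followed by one more vertex. -/
def snoc {k : ℕ} (π : FinPlay Q k) (v : Vertex Q) : FinPlay Q (k + 1) :=
  fun i => if h : i.1 ≤ k then π.at' i.1 h else v

@[simp]
theorem snoc_at {k : ℕ} (π : FinPlay Q k) (v : Vertex Q) (i : ℕ) (hi : i ≤ k) :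
    (π.snoc v).at' i (hi.trans k.le_succ) = π.at' i hi := by
  simp [snoc, at', hi]

@[simp]
theorem snoc_last {k : ℕ} (π : FinPlay Q k) (v : Vertex Q) : (π.snoc v).last = v := by
  simp [snoc, at', last]

@[simp]
theorem pre_at {k : ℕ} (π : FinPlay Q k) (i : ℕ) (hi : i ≤ k) (j : ℕ) (hj : j ≤ i) :
    (π.pre i hi).at' j hj = π.at' j (hj.trans hi) := rfl

@[simp]
theorem pre_last {k : ℕ} (π : FinPlay Q k) (i : ℕ) (hi : i ≤ k) :
    (π.pre i hi).last = π.at' i hi := rfl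

theorem snoc_eq_iff {k : ℕ} {π : FinPlay Q k} {v : Vertex Q} {π' : FinPlay Q (k + 1)} :
    π.snoc v = π' ↔ π = π'.pre k k.le_succ ∧ v = π'.last := by
  constructor
  · rintro rfl
    exact ⟨ext_at fun i hi => (snoc_at π v i hi).symm, (snoc_last π v).symm⟩
  · rintro ⟨rfl, rfl⟩
    refine ext_at fun i hi => ?_
    rcases Nat.lt_or_ge k i with h | h
    · obtain rfl : i = k + 1 := by omega
      exact snoc_last _ _
    · exact snoc_at _ _ i h

end FinPlay

variable {A : Automaton Alph Q} {t : Node → Alph}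

section Run

variable (σ : Strategy A t .eve) (τ : Strategy A t .adam)

/-- The first `k` steps of the play in which the split transitions are resolved by `b`. -/
def runPre (b : Branch) : ∀ k, FinPlay Q k
  | 0 => FinPlay.single (initVertex A)
  | k + 1 => (runPre b k).snoc
      ((choice σ τ (runPre b k)).next (runPre b k).last.node (b (runPre b k).last.node.length))

/-- The play in which the split transitions are resolved by `b`. -/
def run (b : Branch) (k : ℕ) : Vertex Q := (runPre σ τ b k).last

theorem run_zero (b : Branch) : run σ τ b 0 = initVertex A := rfl

theorem run_succ (b : Branch) (k : ℕ) : run σ τ b (k + 1) =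
    (choice σ τ (runPre σ τ b k)).next (run σ τ b k).node (b (run σ τ b k).node.length) := by
  simp [run, runPre]

theorem runPre_at (b : Branch) (k i : ℕ) (hi : i ≤ k) :
    (runPre σ τ b k).at' i hi = run σ τ b i := by
  induction k with
  | zero =>
    obtain rfl : i = 0 := by omega
    rfl
  | succ k ih =>
    rcases Nat.lt_or_ge k i with h | h
    · obtain rfl : i = k + 1 := by omega
      rfl
    · rw [runPre, FinPlay.snoc_at _ _ _ h, ih h]

theorem runPre_pre (b : Branch) (k i : ℕ) (hi : i ≤ k) :
    (runPre σ τ b k).pre i hi = runPre σ τ b i :=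
  FinPlay.ext_at fun j hj => by rw [FinPlay.pre_at, runPre_at, runPre_at]

theorem consistent_runPre (b : Branch) (k : ℕ) : Consistent σ τ (runPre σ τ b k) := by
  refine ⟨runPre_at σ τ b k 0 _, fun i hi => ?_⟩
  rw [runPre_pre, runPre_at, runPre_at, Move.leads_iff, run_succ]
  exact ⟨_, rfl⟩

theorem mem_cone_run (b : Branch) (k : ℕ) : b ∈ cone (run σ τ b k).node := by
  induction k with
  | zero => simp [run_zero, initVertex]
  | succ k ih =>
    rw [run_succ]
    rcases Move.next_node (choice σ τ (runPre σ τ b k)) (run σ τ b k).node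
      (b (run σ τ b k).node.length) with h | h <;> rw [h]
    · exact ih
    · exact mem_cone_append.2 ⟨ih, rfl⟩

theorem run_node_prefix_succ (b : Branch) (k : ℕ) :
    (run σ τ b k).node <+: (run σ τ b (k + 1)).node := by
  rw [run_succ]
  rcases Move.next_node (choice σ τ (runPre σ τ b k)) (run σ τ b k).node
    (b (run σ τ b k).node.length) with h | h <;> rw [h]
  exact List.prefix_append _ _

theorem run_node_prefix (b : Branch) {k k' : ℕ} (h : k ≤ k') :
    (run σ τ b k).node <+: (run σ τ b k').node := by
  induction k', h using Nat.le_induction with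
  | base => exact List.prefix_rfl
  | succ k' _ ih => exact ih.trans (run_node_prefix_succ σ τ b k')

theorem length_run_node_le (b : Branch) (k : ℕ) : (run σ τ b k).node.length ≤ k := by
  induction k with
  | zero => simp [run_zero, initVertex]
  | succ k ih =>
    rw [run_succ]
    rcases Move.next_node (choice σ τ (runPre σ τ b k)) (run σ τ b k).node
      (b (run σ τ b k).node.length) with h | h <;> simp [h] <;> omega

/-- A play is determined by the node it reaches. -/
theorem runPre_eq_of_mem_cone {b b' : Branch} {k : ℕ} (h : b' ∈ cone (run σ τ b k).node) :
    runPre σ τ b' k = runPre σ τ b k := by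
  induction k with
  | zero => rfl
  | succ k ih =>
    have ih := ih (cone_subset_of_prefix (run_node_prefix_succ σ τ b k) h)
    rw [run_succ] at h
    rw [runPre, runPre, ih]
    congr 1
    change Move.next _ (run σ τ b k).node _ = Move.next _ (run σ τ b k).node _
    generalize choice σ τ (runPre σ τ b k) = m at h ⊢
    cases m with
    | loc q' => rfl
    | split r₀ r₁ =>
      have := (mem_cone_append.1 h).2
      change Move.next _ _ (b' (run σ τ b k).node.length) = _
      rw [this]
      rfl

theorem run_eq_of_mem_cone {b b' : Branch} {k i : ℕ} (h : b' ∈ cone (run σ τ b k).node)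
    (hi : i ≤ k) : run σ τ b' i = run σ τ b i := by
  rw [← runPre_at σ τ b' k i hi, runPre_eq_of_mem_cone σ τ h, runPre_at]

/-- Each outcome of the next step is realised by some branch. -/
theorem exists_runPre_succ (b : Branch) (k : ℕ) (d : Bool) :
    ∃ b' ∈ cone (run σ τ b k).node, runPre σ τ b' (k + 1) = (runPre σ τ b k).snoc
      ((choice σ τ (runPre σ τ b k)).next (run σ τ b k).node d) := by
  have hmem : Function.update b (run σ τ b k).node.length d ∈ cone (run σ τ b k).node := by
    rw [← mem_cone.1 (mem_cone_run σ τ b k), mem_cone, Branch.length_pre, Branch.pre_eq_pre_iff]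
    intro i hi
    exact Function.update_of_ne hi.ne _ _
  refine ⟨_, hmem, ?_⟩
  rw [runPre, runPre_eq_of_mem_cone σ τ hmem]
  change FinPlay.snoc _ (Move.next _ _ (Function.update b (run σ τ b k).node.length d
    (run σ τ b k).node.length)) = _
  rw [Function.update_self]
  rfl

/-- Every consistent finite play is driven by a branch. -/
theorem Consistent.exists_runPre {σ : Strategy A t .eve} {τ : Strategy A t .adam} {k : ℕ}
    {π : FinPlay Q k} (hπ : Consistent σ τ π) : ∃ b, runPre σ τ b k = π := by
  induction k with
  | zero =>
    refine ⟨fun _ => false, FinPlay.ext_at fun i hi => ?_⟩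
    obtain rfl : i = 0 := by omega
    exact hπ.1.symm
  | succ k ih =>
    obtain ⟨b, hb⟩ := ih (π := π.pre k k.le_succ) ⟨hπ.1, fun i hi => hπ.2 i (hi.trans k.lt_succ_self)⟩
    have hstep := hπ.2 k k.lt_succ_self
    rw [← hb] at hstep
    obtain ⟨d, hd⟩ := Move.leads_iff.1 hstep
    have hlast : π.at' k k.le_succ = run σ τ b k := by
      rw [← FinPlay.pre_last, ← hb]
      rfl
    obtain ⟨b', -, hb'⟩ := exists_runPre_succ σ τ b k d
    refine ⟨b', ?_⟩
    rw [hb', FinPlay.snoc_eq_iff, ← hlast]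
    exact ⟨hb, hd.symm⟩

/-- After `k` steps the play has read at most `k` coins. -/
theorem isClopen_run_preimage (k : ℕ) (S : Set (Vertex Q)) :
    IsClopen {b | run σ τ b k ∈ S} := by
  refine isClopen_of_pre (k := k) fun b b' h hb => ?_
  have : b' ∈ cone (run σ τ b k).node := by
    have h1 := mem_cone_run σ τ b k
    rw [mem_cone] at h1 ⊢
    rw [← h1, Branch.length_pre, Branch.pre_eq_pre_iff]
    exact fun i hi => (Branch.pre_eq_pre_iff.1 h i (hi.trans_le (length_run_node_le σ τ b k))).symm
  rwa [Set.mem_ofPred_eq, run_eq_of_mem_cone σ τ this le_rfl]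

theorem measurable_run : Measurable (run σ τ) :=
  measurable_pi_lambda _ fun k S _ => (isClopen_run_preimage σ τ k S).isClosed.measurableSet

/-- The branches driving a given finite play form the cone of its last node, or the empty set. The
next step depends only on the following coin, which halves this cone. -/
theorem branchMeasure_runPre_succ (k : ℕ) (π : FinPlay Q (k + 1)) :
    branchMeasure {b | runPre σ τ b (k + 1) = π} =
      branchMeasure {b | runPre σ τ b k = π.pre k k.le_succ} *
        (choice σ τ (π.pre k k.le_succ)).law (π.pre k k.le_succ).last.node {π.last} := by
  set π₀ := π.pre k k.le_succ with hπ₀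
  have hset : {b | runPre σ τ b (k + 1) = π} = {b | runPre σ τ b k = π₀ ∧
      (choice σ τ π₀).next π₀.last.node (b π₀.last.node.length) = π.last} := by
    ext b
    simp only [Set.mem_ofPred_eq, runPre, FinPlay.snoc_eq_iff]
    refine and_congr_right fun h => ?_
    rw [h]
  by_cases hex : ∃ b, runPre σ τ b k = π₀
  · obtain ⟨b₀, hb₀⟩ := hex
    have hcone : {b | runPre σ τ b k = π₀} = cone π₀.last.node := by
      ext b
      constructor
      · rintro h
        rw [← h]
        exact mem_cone_run σ τ b k
      · intro h
        rw [← hb₀] at h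
        exact (runPre_eq_of_mem_cone σ τ h).trans hb₀
    have hset' : {b | runPre σ τ b (k + 1) = π} =
        {b | b ∈ cone π₀.last.node ∧
          (choice σ τ π₀).next π₀.last.node (b π₀.last.node.length) = π.last} := by
      rw [hset, ← hcone]
      rfl
    rw [hset', hcone, Move.law_apply_singleton]
    generalize (choice σ τ π₀) = m
    generalize π₀.last.node = n
    generalize π.last = v
    have hsplit : {b : Branch | b ∈ cone n ∧ m.next n (b n.length) = v} =
        (cone (n ++ [false]) ∩ {_b | m.next n false = v}) ∪
          (cone (n ++ [true]) ∩ {_b | m.next n true = v}) := by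
      ext b
      simp only [Set.mem_ofPred_eq, Set.mem_union, Set.mem_inter_iff, mem_cone_append]
      cases b n.length <;> simp
    have hdisj : Disjoint (cone (n ++ [false]) ∩ {_b | m.next n false = v})
        (cone (n ++ [true]) ∩ {_b | m.next n true = v}) := by
      refine Set.disjoint_left.2 fun b hb hb' => ?_
      have h1 := (mem_cone_append.1 hb.1).2
      have h2 := (mem_cone_append.1 hb'.1).2
      rw [h1] at h2
      exact Bool.false_ne_true h2
    rw [hsplit, measure_union hdisj ((measurableSet_cone _).inter (MeasurableSet.const _)), mul_add]
    congr 1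
    · by_cases h : m.next n false = v <;> simp [h, branchMeasure_cone_append]
    · by_cases h : m.next n true = v <;> simp [h, branchMeasure_cone_append]
  · push Not at hex
    have h1 : {b | runPre σ τ b k = π₀} = ∅ := Set.eq_empty_iff_forall_notMem.2 hex
    have h2 : {b | runPre σ τ b (k + 1) = π} = ∅ := by
      rw [hset]
      exact Set.eq_empty_iff_forall_notMem.2 fun b hb => hex b hb.1
    rw [h1, h2]
    simp

/-! ### The law of plays as an image of the uniform measure on branches. -/

variable [Countable Q]

/-- The chain rule for point masses. Finite plays form a countable space, so point masses determine
their law. -/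
theorem partialTraj_succ_singleton (κ : (k : ℕ) → Kernel (FinPlay Q k) (Vertex Q))
    [∀ k, IsMarkovKernel (κ k)] (π₀ : FinPlay Q 0) (k : ℕ) (π : FinPlay Q (k + 1)) :
    Kernel.partialTraj (X := fun _ => Vertex Q) κ 0 (k + 1) π₀ {π} =
      Kernel.partialTraj (X := fun _ => Vertex Q) κ 0 k π₀ {π.pre k k.le_succ} *
        κ k (π.pre k k.le_succ) {π.last} := by
  rw [Kernel.partialTraj_succ_eq_comp (Nat.zero_le k),
    Kernel.comp_apply' _ _ _ (measurableSet_singleton _)]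
  have h : ∀ ρ : FinPlay Q k,
      Kernel.partialTraj (X := fun _ => Vertex Q) κ k (k + 1) ρ {π} =
        ({π.pre k k.le_succ} : Set (FinPlay Q k)).indicator
          (fun _ => κ k (π.pre k k.le_succ) {π.last}) ρ := by
    intro ρ
    have hsnoc : ∀ v : Vertex Q, IicProdIoc (X := fun _ => Vertex Q) k (k + 1)
        (ρ, MeasurableEquiv.piSingleton (X := fun _ => Vertex Q) k v) = FinPlay.snoc ρ v := by
      intro v
      funext i
      by_cases hi : i.1 ≤ k
      · simp [IicProdIoc, FinPlay.snoc, hi, FinPlay.at']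
      · have : i.1 = k + 1 := by have := Finset.mem_Iic.1 i.2; omega
        simp [IicProdIoc, FinPlay.snoc, hi, MeasurableEquiv.piSingleton]
    rw [Kernel.partialTraj_succ_self, Kernel.map_apply' _ (by fun_prop) _ (measurableSet_singleton _),
      Kernel.id_prod_apply' _ _ (measurableSet_singleton _ |>.preimage (by fun_prop)),
      Kernel.map_apply' _ (by fun_prop) _
        ((measurableSet_singleton _ |>.preimage (by fun_prop)).preimage (by fun_prop))]
    have : (MeasurableEquiv.piSingleton (X := fun _ => Vertex Q) k) ⁻¹' (Prod.mk ρ ⁻¹'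
        (IicProdIoc (X := fun _ => Vertex Q) k (k + 1) ⁻¹' {π})) =
        {v | ρ = π.pre k k.le_succ ∧ v = π.last} := by
      ext v
      simp only [Set.mem_preimage, Set.mem_singleton_iff, hsnoc, FinPlay.snoc_eq_iff]
      rfl
    rw [this]
    by_cases hρ : ρ = π.pre k k.le_succ
    · subst hρ
      simp
    · simp [hρ]
  simp_rw [h]
  rw [lintegral_indicator_const (measurableSet_singleton _), mul_comm]

theorem map_runPre_eq_partialTraj (k : ℕ) :
    branchMeasure.map (fun b => runPre σ τ b k) =
      Kernel.partialTraj (X := fun _ => Vertex Q) (stepKernel σ τ) 0 k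
        (FinPlay.single (initVertex A)) := by
  have hm : ∀ k, Measurable fun b => runPre σ τ b k := fun k =>
    measurable_pi_lambda _ fun i => by
      have : (fun b => runPre σ τ b k i) = fun b => run σ τ b i :=
        funext fun b => runPre_at σ τ b k i (Finset.mem_Iic.1 i.2)
      rw [this]
      exact measurable_pi_iff.1 (measurable_run σ τ) i
  refine Measure.ext_of_singleton fun π => ?_
  rw [Measure.map_apply (hm k) (measurableSet_singleton _)]
  change branchMeasure {b | runPre σ τ b k = π} = _
  induction k with
  | zero =>
    have : Kernel.partialTraj (X := fun _ => Vertex Q) (stepKernel σ τ) 0 0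
        (FinPlay.single (initVertex A)) = Measure.dirac (FinPlay.single (initVertex A)) := by
      rw [Kernel.partialTraj_self, Kernel.id_apply]
    rw [this]
    by_cases h : FinPlay.single (initVertex A) = π <;> simp [runPre, h]
  | succ k ih =>
    rw [branchMeasure_runPre_succ, partialTraj_succ_singleton, ih]
    rfl

/-- The law of the play is the image of the uniform measure on branches. -/
theorem playMeasure_eq_map_run : playMeasure σ τ = branchMeasure.map (run σ τ) := by
  have (I : Finset ℕ) : IsFiniteMeasure (inducedFamily (X := fun _ => Vertex Q)
      (fun k => Kernel.partialTraj (X := fun _ => Vertex Q) (stepKernel σ τ) 0 k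
        (FinPlay.single (initVertex A))) I) := by
    rw [inducedFamily]
    infer_instance
  -- Projective limits of finite measures are unique, so it suffices to compare the laws of the
  -- initial segments.
  refine (Kernel.isProjectiveLimit_trajFun (X := fun _ => Vertex Q) (stepKernel σ τ) 0
    (FinPlay.single (initVertex A))).unique ?_
  rw [isProjectiveLimit_nat_iff (Kernel.isProjectiveMeasureFamily_partialTraj _ _)]
  intro k
  rw [inducedFamily_Iic, ← map_runPre_eq_partialTraj,
    Measure.map_map (Preorder.measurable_frestrictLe k) (measurable_run σ τ)]
  congr 1
  funext b
  exact FinPlay.ext_at fun i hi => (runPre_at σ τ b k i hi).symm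

/-- The branches through the current node after which the play only visits positive states. -/
def positiveBranches (b : Branch) (k : ℕ) : Set Branch :=
  {b' | b' ∈ cone (run σ τ b k).node ∧ ∀ i, k < i → (run σ τ b' i).state ∈ A.Fpos}

theorem playMeasure_positiveContinuations (b : Branch) (k : ℕ) :
    playMeasure σ τ (positiveContinuations A (runPre σ τ b k)) =
      branchMeasure (positiveBranches σ τ b k) := by
  have hmeas : MeasurableSet (positiveContinuations A (runPre σ τ b k)) := by
    have : positiveContinuations A (runPre σ τ b k) =
        (⋂ i, ⋂ (h : i ≤ k), (fun ω => ω i) ⁻¹' {(runPre σ τ b k).at' i h}) ∩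
          ⋂ i, ⋂ (_ : k < i), (fun ω => ω i) ⁻¹' {v | v.state ∈ A.Fpos} := by
      ext ω
      simp [positiveContinuations]
    rw [this]
    refine MeasurableSet.inter ?_ ?_ <;>
    exact MeasurableSet.iInter fun i => MeasurableSet.iInter fun _ =>
      (measurable_pi_apply i) (MeasurableSet.of_discrete)
  rw [playMeasure_eq_map_run, Measure.map_apply (measurable_run σ τ) hmeas]
  congr 1
  ext b'
  refine and_congr_left fun _ => ⟨fun h => ?_, fun h i hi => ?_⟩
  · rw [← runPre_at σ τ b k k le_rfl, ← h k le_rfl]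
    exact mem_cone_run σ τ b' k
  · rw [runPre_at, run_eq_of_mem_cone σ τ h hi]

theorem positivelyWinning_iff {σ : Strategy A t .eve} : PositivelyWinning σ ↔
    ∀ (τ : Strategy A t .adam) (b : Branch) (k : ℕ), (run σ τ b k).state ∈ A.Fpos →
      0 < branchMeasure (positiveBranches σ τ b k) := by
  constructor
  · intro h τ b k hk
    rw [← playMeasure_positiveContinuations]
    exact h τ k _ (consistent_runPre σ τ b k) hk
  · intro h τ k π hπ hk
    obtain ⟨b, rfl⟩ := hπ.exists_runPre
    rw [playMeasure_positiveContinuations]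
    exact h τ b k hk

end Run

end AltNonzero

namespace AltNonzero

variable {Alph Q : Type*}

/-! ### Connected components and single moves. -/

namespace Automaton

variable {A : Automaton Alph Q}

theorem Equivalent.symm {q r : Q} (h : A.Equivalent q r) : A.Equivalent r q := ⟨h.2, h.1⟩

theorem Equivalent.trans {q r s : Q} (h : A.Equivalent q r) (h' : A.Equivalent r s) :
    A.Equivalent q s := ⟨h.1.trans h'.1, h'.2.trans h.2⟩

theorem Equivalent.refl (q : Q) : A.Equivalent q q := ⟨.refl, .refl⟩

theorem Edge.of_next {q : Q} {a : Alph} {m : Move Q} (h : A.trans q a m) (n : Node) (d : Bool) :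
    A.Edge q (m.next n d).state := by
  cases m with
  | loc q' => exact ⟨a, Or.inl h⟩
  | split r₀ r₁ =>
    cases d
    · exact ⟨a, Or.inr ⟨r₁, Or.inl h⟩⟩
    · exact ⟨a, Or.inr ⟨r₀, Or.inr h⟩⟩

/-- Going down strictly in the order of connected components is well-founded. -/
theorem wellFounded_strictlyBelow [Finite Q] (A : Automaton Alph Q) :
    WellFounded fun q' q : Q =>
      Relation.ReflTransGen A.Edge q q' ∧ ¬ Relation.ReflTransGen A.Edge q' q := by
  have : IsTrans Q fun q' q : Q =>
      Relation.ReflTransGen A.Edge q q' ∧ ¬ Relation.ReflTransGen A.Edge q' q :=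
    ⟨fun a b c hab hbc => ⟨hbc.1.trans hab.1, fun h => hab.2 (h.trans hbc.1)⟩⟩
  have : Std.Irrefl fun q' q : Q =>
      Relation.ReflTransGen A.Edge q q' ∧ ¬ Relation.ReflTransGen A.Edge q' q :=
    ⟨fun a h => h.2 .refl⟩
  exact Finite.wellFounded_of_trans_of_irrefl _

theorem Normalized.exists_next_pos (hA : A.Normalized) {q : Q} {a : Alph} {m : Move Q}
    (hq : q ∈ A.Fpos) (h : A.trans q a m) (n : Node) : ∃ d, (m.next n d).state ∈ A.Fpos := by
  cases m with
  | loc q' => exact ⟨false, hA.loc_pos q a q' hq h⟩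
  | split r₀ r₁ =>
    rcases hA.split_pos q a r₀ r₁ hq h with h | h
    · exact ⟨false, h⟩
    · exact ⟨true, h⟩

theorem LimitedChoice.exists_loc (hA : A.LimitedChoice) {q : Q} {a : Alph} {m : Move Q}
    (hq : A.owner q = .adam) (h : A.trans q a m) : ∃ q', m = .loc q' := by
  cases m with
  | loc q' => exact ⟨q', rfl⟩
  | split r₀ r₁ => exact absurd h ((hA q hq).1 a r₀ r₁)

end Automaton

variable {A : Automaton Alph Q} {t : Node → Alph}

theorem choice_of_eve (σ : Strategy A t .eve) (τ : Strategy A t .adam) {k : ℕ} (π : FinPlay Q k)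
    (h : A.owner π.last.state = .eve) : choice σ τ π = (σ k π h).1 := by
  unfold choice
  split
  · rfl
  · rename_i h'
    rw [h] at h'
    cases h'

theorem choice_of_adam (σ : Strategy A t .eve) (τ : Strategy A t .adam) {k : ℕ} (π : FinPlay Q k)
    (h : A.owner π.last.state = .adam) : choice σ τ π = (τ k π h).1 := by
  unfold choice
  split
  · rename_i h'
    rw [h] at h'
    cases h'
  · rfl

theorem trans_choice (σ : Strategy A t .eve) (τ : Strategy A t .adam) {k : ℕ} (π : FinPlay Q k) :
    A.trans π.last.state (t π.last.node) (choice σ τ π) := by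
  cases h : A.owner π.last.state with
  | eve => rw [choice_of_eve σ τ π h]; exact (σ k π h).2
  | adam => rw [choice_of_adam σ τ π h]; exact (τ k π h).2

theorem Positional.choice_eq {σ : Strategy A t .eve} (hσ : Positional σ) (τ : Strategy A t .adam)
    {k : ℕ} (π : FinPlay Q k) {z : Vertex Q} (hz : π.last = z) (h : A.owner z.state = .eve) :
    choice σ τ π = moveAt σ z h := by
  subst hz
  rw [choice_of_eve σ τ π h]
  exact hσ _ _ π (FinPlay.single π.last) h h rfl

theorem reflTransGen_run (σ : Strategy A t .eve) (τ : Strategy A t .adam) (b : Branch) {k k' : ℕ}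
    (h : k ≤ k') : Relation.ReflTransGen A.Edge (run σ τ b k).state (run σ τ b k').state := by
  induction k', h using Nat.le_induction with
  | base => exact .refl
  | succ k' _ ih =>
    refine ih.tail ?_
    rw [run_succ]
    exact Automaton.Edge.of_next (trans_choice σ τ (runPre σ τ b k')) _ _

theorem reachable_run (σ : Strategy A t .eve) (τ : Strategy A t .adam) (b : Branch) (k : ℕ) :
    Reachable σ (run σ τ b k) :=
  ⟨k, runPre σ τ b k, (consistent_runPre σ τ b k).1, ⟨τ, (consistent_runPre σ τ b k).2⟩, rfl⟩

/-- All states visited by the play driven by `b` after time `k` and until time `k'` are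
positive. -/
def PositiveBetween (σ : Strategy A t .eve) (τ : Strategy A t .adam) (b : Branch) (k k' : ℕ) :
    Prop :=
  ∀ i, k < i → i ≤ k' → (run σ τ b i).state ∈ A.Fpos

/-! ### From a positive witness to positive winning. -/

section Sufficiency

variable {σ : Strategy A t .eve} {τ : Strategy A t .adam}

/-- A lower bound obtained later on a positive continuation transfers back to the present vertex. -/
theorem positiveBranches_subset {b b' : Branch} {k k' : ℕ} (hb' : b' ∈ cone (run σ τ b k).node)
    (hk : k ≤ k') (hpos : PositiveBetween σ τ b' k k') :
    positiveBranches σ τ b' k' ⊆ positiveBranches σ τ b k := by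
  rintro x ⟨hx, hxpos⟩
  have hrun : run σ τ b' k = run σ τ b k := run_eq_of_mem_cone σ τ hb' le_rfl
  refine ⟨?_, fun i hi => ?_⟩
  · rw [← hrun]
    exact cone_subset_of_prefix (run_node_prefix σ τ b' hk) hx
  · rcases lt_or_ge k' i with h | h
    · exact hxpos i h
    · rw [run_eq_of_mem_cone σ τ hx h]
      exact hpos i hi h

/-- The positive continuations of the play driven by `b` stay in the connected component of
its state at time `k`. -/
def StaysEquivalent (σ : Strategy A t .eve) (τ : Strategy A t .adam) (b : Branch) (k : ℕ) : Prop :=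
  ∀ b' ∈ cone (run σ τ b k).node, ∀ k' ≥ k, PositiveBetween σ τ b' k k' →
    A.Equivalent (run σ τ b k).state (run σ τ b' k').state

/-- Adam's move is local, so by normalization its target is again positive. It is thus reached by a
positive continuation and stays in the component. -/
theorem StaysEquivalent.canonicalStep (hnorm : A.Normalized) (hlimited : A.LimitedChoice)
    {b : Branch} {k : ℕ} (hclosed : StaysEquivalent σ τ b k) (hk : (run σ τ b k).state ∈ A.Fpos)
    {b' : Branch} (hb' : b' ∈ cone (run σ τ b k).node) {k' : ℕ} (hk' : k ≤ k')
    (hpos : PositiveBetween σ τ b' k k') (hadam : A.owner (run σ τ b' k').state = .adam) :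
    CanonicalStep A t (run σ τ b' k') (run σ τ b' (k' + 1)) := by
  have htrans := trans_choice σ τ (runPre σ τ b' k')
  obtain ⟨q', hq'⟩ := hlimited.exists_loc hadam htrans
  have hsucc : run σ τ b' (k' + 1) = ⟨(run σ τ b' k').node, q'⟩ := by
    rw [run_succ, hq']
    rfl
  rw [hq'] at htrans
  have hF : (run σ τ b' k').state ∈ A.Fpos := by
    rcases hk'.eq_or_lt with rfl | h
    · rwa [run_eq_of_mem_cone σ τ hb' le_rfl]
    · exact hpos k' h le_rfl
  have hpos' : PositiveBetween σ τ b' k (k' + 1) := by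
    intro i hi hi'
    rcases Nat.le_succ_iff.1 hi' with h | rfl
    · exact hpos i hi h
    · rw [hsucc]
      exact hnorm.loc_pos _ _ _ hF htrans
  have h1 := hclosed b' hb' k' hk' hpos
  have h2 := hclosed b' hb' (k' + 1) (hk'.trans k'.le_succ) hpos'
  rw [hsucc] at h2 ⊢
  exact ⟨rfl, htrans, h1.symm.trans h2⟩

/-- If positive continuations do not leave the connected component, then Adam has to follow
the positive canonical plays of Eve. -/
theorem StaysEquivalent.exists_follow (hnorm : A.Normalized) (hlimited : A.LimitedChoice)
    (hσ : Positional σ) {b : Branch} {k : ℕ} (hclosed : StaysEquivalent σ τ b k)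
    (hk : (run σ τ b k).state ∈ A.Fpos) {l : ℕ} {ρ : FinPlay Q l} (hfirst : ρ.first = run σ τ b k)
    (hρ : IsSigmaPlay σ ρ) (hpos : PositivePlay A ρ) (hcan : CanonicalPlay A t ρ) :
    ∃ b' ∈ cone (run σ τ b k).node, PositiveBetween σ τ b' k (k + l) ∧
      run σ τ b' (k + l) = ρ.last := by
  suffices h : ∀ (j : ℕ) (hj : j ≤ l), ∃ b' ∈ cone (run σ τ b k).node,
      PositiveBetween σ τ b' k (k + j) ∧ run σ τ b' (k + j) = ρ.at' j hj from h l le_rfl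
  intro j
  induction j with
  | zero =>
    exact fun _ => ⟨b, mem_cone_run σ τ b k, fun i hi hi' => absurd hi (by omega), hfirst.symm⟩
  | succ j ih =>
    intro hj
    obtain ⟨b', hb', hpos', hrun⟩ := ih (by omega)
    -- Eve's moves agree because `σ` is positional, Adam's because both are canonical and limited
    -- choice allows only one such move.
    have hstep : ∃ d, ρ.at' (j + 1) hj =
        (choice σ τ (runPre σ τ b' (k + j))).next (run σ τ b' (k + j)).node d := by
      cases howner : A.owner (run σ τ b' (k + j)).state with
      | eve =>
        obtain ⟨τ', hτ'⟩ := hρ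
        have h := Move.leads_iff.1 (hτ' j hj)
        rw [hσ.choice_eq τ' (ρ.pre j _) (z := run σ τ b' (k + j)) hrun.symm howner] at h
        rw [hσ.choice_eq τ (runPre σ τ b' (k + j)) rfl howner, hrun]
        exact h
      | adam =>
        refine ⟨b' (run σ τ b' (k + j)).node.length, ?_⟩
        have h := hclosed.canonicalStep hnorm hlimited hk hb' (Nat.le_add_right k j) hpos' howner
        rw [← run_succ]
        have h' := hcan j hj (by rw [← hrun]; exact howner)
        rw [← hrun] at h'
        have hstate := (hlimited _ howner).2 _ _ _ h.2 h'.2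
        have hnode := h.1.trans h'.1.symm
        revert hstate hnode
        generalize run σ τ b' (k + j + 1) = u
        generalize ρ.at' (j + 1) hj = v
        rcases u with ⟨u, q⟩
        rcases v with ⟨v, r⟩
        rintro rfl rfl
        rfl
    obtain ⟨d, hd⟩ := hstep
    obtain ⟨b'', hb'', hrun''⟩ := exists_runPre_succ σ τ b' (k + j) d
    rw [← hd] at hrun''
    have hlast : run σ τ b'' (k + (j + 1)) = ρ.at' (j + 1) hj := by
      rw [← add_assoc, run, hrun'', FinPlay.snoc_last]
    refine ⟨b'', ?_, fun i hi hi' => ?_, hlast⟩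
    · rw [← run_eq_of_mem_cone σ τ hb' le_rfl]
      exact cone_subset_of_prefix (run_node_prefix σ τ b' (Nat.le_add_right k j)) hb''
    · rcases Nat.le_succ_iff.1 hi' with h | rfl
      · rw [run_eq_of_mem_cone σ τ hb'' h]
        exact hpos' i hi h
      · exact hlast ▸ hpos (j + 1) hj

/-- From an active vertex, the plays driven by the branches that stay in the positive edges only
visit active vertices. -/
theorem StaysEquivalent.run_mem_active (hnorm : A.Normalized) (hlimited : A.LimitedChoice)
    (hσ : Positional σ) {W : Set (Vertex Q)} {E : Set (Node × Bool)} (hW : PositiveWitness σ W E)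
    {b : Branch} {k : ℕ} (hclosed : StaysEquivalent σ τ b k) (hk : (run σ τ b k).state ∈ A.Fpos)
    {x : Branch} (hx : x ∈ cone (run σ τ b k).node) {k' : ℕ} (hk' : k ≤ k')
    (hpos : PositiveBetween σ τ x k k') (hmem : run σ τ x k' ∈ W)
    (hstay : ∀ j, (run σ τ x k').node.length < j → x.pre j ∈ {n | ∃ e ∈ E, n = e.1 ++ [e.2]})
    (i : ℕ) : ∀ j, k' ≤ j → j ≤ k' + i → run σ τ x j ∈ W := by
  induction i with
  | zero =>
    intro j hj hj'
    obtain rfl : j = k' := by omega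
    exact hmem
  | succ i ih =>
    intro j hj hj'
    rcases Nat.le_succ_iff.1 hj' with h | rfl
    · exact ih j hj h
    set l := k' + i with hl
    have hz : run σ τ x l ∈ W := ih l (by omega) le_rfl
    have hposl : PositiveBetween σ τ x k l := by
      intro j hj hj'
      rcases le_or_gt j k' with h | h
      · exact hpos j hj h
      · exact (hW.active _ (ih j h.le hj')).2
    change run σ τ x (l + 1) ∈ W
    cases howner : A.owner (run σ τ x l).state with
    | adam =>
      exact hW.adam_loc _ hz howner _
        (hclosed.canonicalStep hnorm hlimited hk hx (by omega) hposl howner)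
    | eve =>
      rw [run_succ, hσ.choice_eq τ (runPre σ τ x l) (z := run σ τ x l) rfl howner]
      cases hm : moveAt σ (run σ τ x l) howner with
      | loc q' => exact hW.eve_loc _ hz howner q' hm
      | split r₀ r₁ =>
        -- The prefix of `x` one level below the current node is the target of an edge of `E`, and a
        -- target determines its edge.
        have hE : ((run σ τ x l).node, x (run σ τ x l).node.length) ∈ E := by
          have hlen := (run_node_prefix σ τ x (k := k') (k' := l) (by omega)).length_le
          obtain ⟨⟨n, d⟩, he, h⟩ := hstay ((run σ τ x l).node.length + 1) (by omega)
          rw [Branch.pre_succ, mem_cone.1 (mem_cone_run σ τ x l)] at h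
          have h' := List.append_inj' h rfl
          simp only [List.cons.injEq, and_true] at h'
          rwa [h'.1, h'.2] at *
        have h := hW.eve_split _ hz howner r₀ r₁ hm
        revert hE
        cases hd : x (run σ τ x l).node.length
        · exact h.1
        · exact h.2

/-- The induction is on the connected component of the state; only in a component that positive
continuations cannot leave are conditions a), b) and c) needed. -/
theorem PositiveWitness.positiveBranches_pos [Finite Q] (hnorm : A.Normalized)
    (hlimited : A.LimitedChoice) (hσ : Positional σ) {W : Set (Vertex Q)} {E : Set (Node × Bool)}
    (hW : PositiveWitness σ W E) (q : Q) : ∀ (b : Branch) (k : ℕ), (run σ τ b k).state = q →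
      q ∈ A.Fpos → 0 < branchMeasure (positiveBranches σ τ b k) := by
  induction q using A.wellFounded_strictlyBelow.induction with
  | _ q ih =>
  rintro b k rfl hk
  by_cases hclosed : StaysEquivalent σ τ b k
  swap
  · unfold StaysEquivalent at hclosed
    push Not at hclosed
    obtain ⟨b', hb', k', hk', hpos, hne⟩ := hclosed
    have hrun : run σ τ b' k = run σ τ b k := run_eq_of_mem_cone σ τ hb' le_rfl
    have hlt : k < k' := by
      refine lt_of_le_of_ne hk' ?_
      rintro rfl
      exact hne (hrun ▸ Automaton.Equivalent.refl _)
    have hreach := reflTransGen_run σ τ b' hk'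
    rw [hrun] at hreach
    exact (ih _ ⟨hreach, fun h => hne ⟨hreach, h⟩⟩ b' k' rfl (hpos k' hlt le_rfl)).trans_le
      (measure_mono (positiveBranches_subset hb' hk' hpos))
  obtain ⟨l, ρ, hfirst, hρ, hρpos, hcan, hlast⟩ := hW.reach _ (reachable_run σ τ b k) hk
  obtain ⟨b', hb', hpos, hrun⟩ :=
    hclosed.exists_follow hnorm hlimited hσ hk hfirst hρ hρpos hcan
  have hFl : (run σ τ b' (k + l)).state ∈ A.Fpos := hrun ▸ hρpos l le_rfl
  have hcone : cone (run σ τ b' (k + l)).node ⊆ cone (run σ τ b k).node := by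
    rw [← run_eq_of_mem_cone σ τ hb' le_rfl]
    exact cone_subset_of_prefix (run_node_prefix σ τ b' (Nat.le_add_right k l))
  rcases hlast with hlast | hlast
  · rw [← hrun] at hlast
    obtain ⟨d, hd⟩ : ∃ d, ((run σ τ b' (k + l)).node, d) ∈ E := by
      rcases hW.edge _ hlast with h | h
      exacts [⟨_, h⟩, ⟨_, h⟩]
    -- Thickness concerns targets of edges, so it is applied at a son of the current node; that node
    -- itself need not be a target.
    refine (hW.thick _ ⟨_, hd, rfl⟩).trans_le (measure_mono ?_)
    rintro x ⟨hx, hstay⟩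
    have hx' : x ∈ cone (run σ τ b' (k + l)).node := cone_append_subset _ _ hx
    have hposx : PositiveBetween σ τ x k (k + l) := by
      intro i hi hi'
      rw [run_eq_of_mem_cone σ τ hx' hi']
      exact hpos i hi hi'
    have hrunx : run σ τ x (k + l) = run σ τ b' (k + l) := run_eq_of_mem_cone σ τ hx' le_rfl
    have hact := hclosed.run_mem_active hnorm hlimited hσ hW hk (hcone hx') (Nat.le_add_right k l)
      hposx (hrunx ▸ hlast) (fun j hj => hstay j (by
        rw [hrunx] at hj
        simpa using hj))
    refine ⟨hcone hx', fun i hi => ?_⟩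
    rcases le_or_gt i (k + l) with h | h
    · exact hposx i hi h
    · exact (hW.active _ (hact i i h.le (by omega))).2
  -- At a transient vertex, normalization still yields a positive successor, and transience puts it
  -- outside the component.
  · exfalso
    rw [← hrun] at hlast
    have htrans := trans_choice σ τ (runPre σ τ b' (k + l))
    obtain ⟨d, hd⟩ := hnorm.exists_next_pos hFl htrans (run σ τ b' (k + l)).node
    obtain ⟨b'', hb'', hrun''⟩ := exists_runPre_succ σ τ b' (k + l) d
    have hsucc : run σ τ b'' (k + l + 1) =
        (choice σ τ (runPre σ τ b' (k + l))).next (run σ τ b' (k + l)).node d := by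
      rw [run, hrun'', FinPlay.snoc_last]
    refine hlast _ _ htrans (Move.leads_iff.2 ⟨d, rfl⟩) ?_
    rw [← hsucc]
    refine (hclosed b' hb' (k + l) (Nat.le_add_right k l) hpos).symm.trans
      (hclosed b'' (hcone hb'') (k + l + 1) (by omega) fun i hi hi' => ?_)
    rcases Nat.le_succ_iff.1 hi' with h | rfl
    · rw [run_eq_of_mem_cone σ τ hb'' h]
      exact hpos i hi h
    · exact hsucc ▸ hd

end Sufficiency

end AltNonzero

namespace AltNonzero

variable {Alph Q : Type*} {A : Automaton Alph Q} {t : Node → Alph}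

/-! ### Canonical plays -/

/-- The positional choice of moves `f` agrees with `σ` for Eve, and is canonical for Adam whenever
possible. -/
structure IsCanonicalChoice (σ : Strategy A t .eve) (f : Vertex Q → Move Q) : Prop where
  trans : ∀ z, A.trans z.state (t z.node) (f z)
  eve : ∀ z h, f z = moveAt σ z h
  adam : ∀ z, A.owner z.state = .adam → ∀ z', CanonicalStep A t z z' → f z = .loc z'.state

theorem exists_isCanonicalChoice (hcomplete : A.Complete) (hlimited : A.LimitedChoice)
    (σ : Strategy A t .eve) : ∃ f, IsCanonicalChoice σ f := by
  have h : ∀ z : Vertex Q, ∃ m, A.trans z.state (t z.node) m ∧ (∀ h, m = moveAt σ z h) ∧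
      (A.owner z.state = .adam → ∀ z', CanonicalStep A t z z' → m = .loc z'.state) := by
    intro z
    have hor : A.owner z.state = .eve ∨ A.owner z.state = .adam := by
      cases A.owner z.state <;> simp
    rcases hor with howner | howner
    · exact ⟨moveAt σ z howner, (σ 0 (FinPlay.single z) howner).2, fun _ => rfl,
        fun h => (nomatch howner.symm.trans h)⟩
    · by_cases hex : ∃ z', CanonicalStep A t z z'
      · obtain ⟨z', hz'⟩ := hex
        refine ⟨.loc z'.state, hz'.2.1, fun h => (nomatch howner.symm.trans h), fun _ z'' hz'' => ?_⟩
        rw [(hlimited _ howner).2 _ _ _ hz'.2 hz''.2]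
      · obtain ⟨m, hm⟩ := hcomplete z.state (t z.node)
        exact ⟨m, hm, fun h => (nomatch howner.symm.trans h), fun _ z' hz' => absurd ⟨z', hz'⟩ hex⟩
  choose f h1 h2 h3 using h
  exact ⟨f, h1, h2, h3⟩

section Guided

variable (f : Vertex Q → Move Q)

/-- The play from `z` with the moves given by `f`, split transitions being resolved by `b`. -/
def guided (z : Vertex Q) (b : Branch) : ℕ → Vertex Q
  | 0 => z
  | i + 1 => (f (guided z b i)).next (guided z b i).node (b (guided z b i).node.length)

theorem guided_succ (z : Vertex Q) (b : Branch) (i : ℕ) : guided f z b (i + 1) =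
    (f (guided f z b i)).next (guided f z b i).node (b (guided f z b i).node.length) := rfl

theorem guided_add (z : Vertex Q) (b : Branch) (i j : ℕ) :
    guided f z b (i + j) = guided f (guided f z b i) b j := by
  induction j with
  | zero => rfl
  | succ j ih => rw [← add_assoc, guided_succ, guided_succ, ih]

theorem guided_node_succ (z : Vertex Q) (b : Branch) (i : ℕ) :
    (guided f z b (i + 1)).node = (guided f z b i).node ∨
      (guided f z b (i + 1)).node =
        (guided f z b i).node ++ [b (guided f z b i).node.length] :=
  Move.next_node _ _ _

theorem guided_node_prefix (z : Vertex Q) (b : Branch) {i j : ℕ} (h : i ≤ j) :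
    (guided f z b i).node <+: (guided f z b j).node := by
  induction j, h using Nat.le_induction with
  | base => exact List.prefix_rfl
  | succ j _ ih =>
    rcases guided_node_succ f z b j with h | h <;> rw [h]
    · exact ih
    · exact ih.trans (List.prefix_append _ _)

theorem mem_cone_guided {z : Vertex Q} {b : Branch} (hb : b ∈ cone z.node) (i : ℕ) :
    b ∈ cone (guided f z b i).node := by
  induction i with
  | zero => exact hb
  | succ i ih =>
    rcases guided_node_succ f z b i with h | h <;> rw [h]
    · exact ih
    · exact mem_cone_append.2 ⟨ih, rfl⟩

/-- The play has read only coins above its current node. This allows changing the branch below that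
node. -/
theorem guided_congr (z : Vertex Q) {b b' : Branch} {i : ℕ}
    (h : ∀ j < (guided f z b i).node.length, b j = b' j) : guided f z b' i = guided f z b i := by
  induction i with
  | zero => rfl
  | succ i ih =>
    have ih := ih fun j hj =>
      h j (hj.trans_le (guided_node_prefix f z b (Nat.le_succ i)).length_le)
    rw [guided_succ] at h
    rw [guided_succ, guided_succ, ih]
    generalize guided f z b i = w at h ⊢
    cases hm : f w with
    | loc q' => rfl
    | split r₀ r₁ =>
      rw [h]
      simp [hm, Move.next]

theorem length_guided_node_le (z : Vertex Q) (b : Branch) (i : ℕ) :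
    (guided f z b i).node.length ≤ z.node.length + i := by
  induction i with
  | zero => exact le_rfl
  | succ i ih => rcases guided_node_succ f z b i with h | h <;> simp [h] <;> omega

theorem isClopen_guided_preimage (z : Vertex Q) (i : ℕ) (S : Set (Vertex Q)) :
    IsClopen {b | guided f z b i ∈ S} := by
  refine isClopen_of_pre (k := z.node.length + i) fun b b' h hb => ?_
  rwa [Set.mem_ofPred_eq, guided_congr f z fun j hj =>
    Branch.pre_eq_pre_iff.1 h j (hj.trans_le (length_guided_node_le f z b i))]

/-- The branches through `z` along which the play guided by `f` is positive. -/
def guidedPositive (A : Automaton Alph Q) (z : Vertex Q) : Set Branch :=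
  {b | b ∈ cone z.node ∧ ∀ i, (guided f z b i).state ∈ A.Fpos}

theorem isClosed_guidedPositive (z : Vertex Q) : IsClosed (guidedPositive f A z) := by
  have : guidedPositive f A z =
      cone z.node ∩ ⋂ i, {b | guided f z b i ∈ {v | v.state ∈ A.Fpos}} := by
    ext b
    simp [guidedPositive]
  rw [this]
  exact (isClopen_cone _).isClosed.inter
    (isClosed_iInter fun i => (isClopen_guided_preimage f z i _).isClosed)

variable {f} {σ : Strategy A t .eve}

/-- Without local loop, plays go down in the tree. -/
theorem IsCanonicalChoice.exists_guided_length_succ [Finite Q] (hf : IsCanonicalChoice σ f)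
    (hloop : A.NoLocalLoop) (z : Vertex Q) (b : Branch) :
    ∃ i, (guided f z b i).node.length = z.node.length + 1 := by
  by_contra! hne
  -- The depth grows by at most one per step, so a play that misses the next level stays at its
  -- node. Finitely many states then force a local cycle on one letter.
  have hnode : ∀ i, (guided f z b i).node = z.node := by
    intro i
    induction i with
    | zero => rfl
    | succ i ih =>
      rcases guided_node_succ f z b i with h | h
      · rw [h, ih]
      · exact absurd (by simp [h, ih]) (hne (i + 1))
  have hstep : ∀ i, A.trans (guided f z b i).state (t z.node)
      (.loc (guided f z b (i + 1)).state) := by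
    intro i
    have h := hf.trans (guided f z b i)
    have h' := hnode (i + 1)
    rw [hnode i] at h
    rw [guided_succ] at h' ⊢
    cases hm : f (guided f z b i) with
    | loc q' => rwa [hm] at h
    | split r₀ r₁ =>
      rw [hm] at h'
      have := congrArg List.length h'
      simp [Move.next, hnode i] at this
  have hpath : ∀ i j, i < j → Relation.TransGen (fun r r' => A.trans r (t z.node) (.loc r'))
      (guided f z b i).state (guided f z b j).state := by
    intro i j hij
    induction j, hij using Nat.le_induction with
    | base => exact .single (hstep i)
    | succ j _ ih => exact ih.tail (hstep j)
  obtain ⟨i, j, hij, h⟩ := Finite.exists_ne_map_eq_of_infinite fun i => (guided f z b i).state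
  rcases hij.lt_or_gt with hlt | hlt
  · exact hloop _ _ (h ▸ hpath i j hlt)
  · exact hloop _ _ (h ▸ hpath j i hlt)

theorem IsCanonicalChoice.exists_guided_node [Finite Q] (hf : IsCanonicalChoice σ f)
    (hloop : A.NoLocalLoop) {z : Vertex Q} {b : Branch} (hz : b ∈ cone z.node) {n : Node}
    (hn : b ∈ cone n) (hle : z.node.length ≤ n.length) : ∃ i, (guided f z b i).node = n := by
  suffices h : ∀ ℓ ≥ z.node.length, ∃ i, (guided f z b i).node.length = ℓ by
    obtain ⟨i, hi⟩ := h _ hle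
    refine ⟨i, ?_⟩
    rw [← mem_cone.1 (mem_cone_guided f hz i), hi, mem_cone.1 hn]
  intro ℓ hℓ
  induction ℓ, hℓ using Nat.le_induction with
  | base => exact ⟨0, rfl⟩
  | succ ℓ _ ih =>
    obtain ⟨i, hi⟩ := ih
    obtain ⟨j, hj⟩ := hf.exists_guided_length_succ hloop (guided f z b i) b
    exact ⟨i + j, by rw [guided_add, hj, hi]⟩

/-- The strategy of Adam that follows `τ` for `k` steps and then `f`. -/
noncomputable def IsCanonicalChoice.late (hf : IsCanonicalChoice σ f) (τ : Strategy A t .adam)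
    (k : ℕ) : Strategy A t .adam :=
  fun k' π h => if k' < k then τ k' π h else ⟨f π.last, hf.trans π.last⟩

theorem IsCanonicalChoice.choice_late_of_lt (hf : IsCanonicalChoice σ f) (τ : Strategy A t .adam)
    {k k' : ℕ} (hk : k' < k) (π : FinPlay Q k') : choice σ (hf.late τ k) π = choice σ τ π := by
  cases h : A.owner π.last.state with
  | eve => rw [choice_of_eve _ _ _ h, choice_of_eve _ _ _ h]
  | adam => rw [choice_of_adam _ _ _ h, choice_of_adam _ _ _ h, late, if_pos hk]

theorem IsCanonicalChoice.choice_late_of_le (hσ : Positional σ) (hf : IsCanonicalChoice σ f)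
    (τ : Strategy A t .adam) {k k' : ℕ} (hk : k ≤ k') (π : FinPlay Q k') :
    choice σ (hf.late τ k) π = f π.last := by
  cases h : A.owner π.last.state with
  | eve => rw [hσ.choice_eq _ π rfl h, hf.eve _ h]
  | adam => rw [choice_of_adam _ _ _ h, late, if_neg hk.not_gt]

/-- The play guided by `f` from a reachable vertex is a suffix of a play from the initial
vertex. -/
theorem IsCanonicalChoice.exists_run_eq_guided (hσ : Positional σ) (hf : IsCanonicalChoice σ f)
    {z : Vertex Q} (hz : Reachable σ z) : ∃ (τ : Strategy A t .adam) (b : Branch) (k : ℕ),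
      run σ τ b k = z ∧ ∀ b' ∈ cone z.node, ∀ i, run σ τ b' (k + i) = guided f z b' i := by
  obtain ⟨k, π, hfirst, ⟨τ, hτ⟩, rfl⟩ := hz
  have hcons : Consistent σ (hf.late τ k) π := by
    refine ⟨hfirst, fun i hi => ?_⟩
    rw [hf.choice_late_of_lt τ hi]
    exact hτ i hi
  obtain ⟨b, rfl⟩ := hcons.exists_runPre
  refine ⟨hf.late τ k, b, k, rfl, fun b' hb' i => ?_⟩
  induction i with
  | zero => exact run_eq_of_mem_cone _ _ hb' le_rfl
  | succ i ih =>
    rw [← add_assoc, run_succ, hf.choice_late_of_le hσ τ (Nat.le_add_right k i), guided_succ, ← ih]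
    rfl

/-- Positive winning is applied against the Adam who first steers to `z` and then plays `f`. -/
theorem IsCanonicalChoice.guidedPositive_pos [Countable Q] (hσ : Positional σ)
    (hf : IsCanonicalChoice σ f) (hwin : PositivelyWinning σ) {z : Vertex Q}
    (hz : Reachable σ z) (hpos : z.state ∈ A.Fpos) :
    0 < branchMeasure (guidedPositive f A z) := by
  obtain ⟨τ, b, k, rfl, hrun⟩ := hf.exists_run_eq_guided hσ hz
  refine (positivelyWinning_iff.1 hwin τ b k hpos).trans_le (measure_mono ?_)
  rintro b' ⟨hb', hb'pos⟩
  refine ⟨hb', fun i => ?_⟩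
  cases i with
  | zero => exact hpos
  | succ i =>
    rw [← hrun b' hb']
    exact hb'pos _ (by omega)

/-- A non-transient vertex of Adam has an equivalent successor; as his moves are local, it gives a
canonical transition, which `f` must select. -/
theorem IsCanonicalChoice.canonicalStep (hlimited : A.LimitedChoice) (hf : IsCanonicalChoice σ f)
    {z : Vertex Q} (hz : ¬ TransientVertex A t z) (howner : A.owner z.state = .adam) (d : Bool) :
    CanonicalStep A t z ((f z).next z.node d) := by
  unfold TransientVertex at hz
  push Not at hz
  obtain ⟨m, z', hm, hlead, heq⟩ := hz
  obtain ⟨q', rfl⟩ := hlimited.exists_loc howner hm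
  obtain rfl : z' = ⟨z.node, q'⟩ := hlead
  have hcan : CanonicalStep A t z ⟨z.node, q'⟩ := ⟨rfl, hm, heq⟩
  rw [hf.adam z howner _ hcan]
  exact hcan

/-- A play guided by `f` that is positive and does not meet transient vertices before its end is a
positive and canonical `σ`-play. -/
theorem IsCanonicalChoice.exists_play (hσ : Positional σ) (hlimited : A.LimitedChoice)
    (hf : IsCanonicalChoice σ f) {z : Vertex Q} {b : Branch} {i : ℕ}
    (hpos : ∀ j ≤ i, (guided f z b j).state ∈ A.Fpos)
    (htrans : ∀ j < i, ¬ TransientVertex A t (guided f z b j)) :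
    ∃ (k : ℕ) (π : FinPlay Q k), π.first = z ∧ IsSigmaPlay σ π ∧ PositivePlay A π ∧
      CanonicalPlay A t π ∧ π.last = guided f z b i := by
  have τ₀ : Strategy A t .adam := fun _ π _ => ⟨f π.last, hf.trans _⟩
  refine ⟨i, fun j => guided f z b j, rfl, ⟨hf.late τ₀ 0, fun j hj => ?_⟩, hpos,
    fun j hj howner => hf.canonicalStep hlimited (htrans j hj) howner _, rfl⟩
  rw [hf.choice_late_of_le hσ τ₀ (Nat.zero_le _), Move.leads_iff]
  exact ⟨_, rfl⟩

end Guided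

/-- A positively winning positional strategy has a positive witness. -/
theorem exists_positiveWitness [Finite Q] (hcomplete : A.Complete) (hlimited : A.LimitedChoice)
    (hloop : A.NoLocalLoop) {σ : Strategy A t .eve} (hσ : Positional σ)
    (hwin : PositivelyWinning σ) :
    ∃ (W : Set (Vertex Q)) (E : Set (Node × Bool)), PositiveWitness σ W E := by
  obtain ⟨f, hf⟩ := exists_isCanonicalChoice hcomplete hlimited σ
  -- For the other positive reachable vertices, condition a) is met by a transient vertex; only
  -- these need active vertices.
  let Recurrent : Vertex Q → Prop := fun z => Reachable σ z ∧ z.state ∈ A.Fpos ∧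
    ∀ b ∈ cone z.node, ∀ i, (∀ j ≤ i, (guided f z b j).state ∈ A.Fpos) →
      ¬ TransientVertex A t (guided f z b i)
  obtain ⟨E, hthick, hE⟩ := exists_thick_edges
    (B := fun z : {z // Recurrent z} => guidedPositive f A z.1)
    (fun z => isClosed_guidedPositive f z.1)
    (fun z => hf.guidedPositive_pos hσ hwin z.2.1 z.2.2.1) (fun z => z.1.node.length)
  choose G hGne hG using hE
  -- Active vertices lie on positive guided plays from some recurrent `z`, at nodes of `G z`. The
  -- branch `b` may leave `G z` afterwards; it only certifies positivity.
  refine ⟨{w | ∃ (z : {z // Recurrent z}) (b : Branch) (i : ℕ), b ∈ guidedPositive f A z.1 ∧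
    w.node ∈ G z ∧ guided f z.1 b i = w}, E, ?_, ?_, ?_, ?_, ?_, ?_, hthick⟩
  · rintro _ ⟨z, b, i, hb, -, rfl⟩
    refine ⟨?_, hb.2 i⟩
    obtain ⟨τ, -, k, -, hrun⟩ := hf.exists_run_eq_guided hσ z.2.1
    rw [← hrun b hb.1]
    exact reachable_run σ τ b _
  · intro z hz hzpos
    by_cases hrec : Recurrent z
    · obtain ⟨n, hn⟩ := hGne ⟨z, hrec⟩
      obtain ⟨hlen, ⟨b, hb, hbn⟩, -⟩ := hG _ n hn
      -- The length bound places `n` at or below the node of `z`, so the guided play along `b`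
      -- passes through `n`.
      obtain ⟨i, hi⟩ := hf.exists_guided_node hloop hb.1 hbn hlen
      obtain ⟨k, π, h1, h2, h3, h4, h5⟩ := hf.exists_play hσ hlimited (i := i)
        (fun j _ => hb.2 j) (fun j _ => hrec.2.2 b hb.1 j fun j' _ => hb.2 j')
      exact ⟨k, π, h1, h2, h3, h4, Or.inl ⟨⟨z, hrec⟩, b, i, hb, by rw [h5, hi]; exact hn, h5.symm⟩⟩
    · have hex : ∃ b ∈ cone z.node, ∃ i, (∀ j ≤ i, (guided f z b j).state ∈ A.Fpos) ∧
          TransientVertex A t (guided f z b i) := by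
        by_contra! h
        exact hrec ⟨hz, hzpos, h⟩
      classical
      obtain ⟨b, -, hi⟩ := hex
      -- Stopping at the first transient vertex keeps Adam's earlier moves canonical.
      obtain ⟨hpos, htrans⟩ := Nat.find_spec hi
      obtain ⟨k, π, h1, h2, h3, h4, h5⟩ := hf.exists_play hσ hlimited hpos fun j hj ht =>
        Nat.find_min hi hj ⟨fun j' hj' => hpos j' (hj'.trans hj.le), ht⟩
      exact ⟨k, π, h1, h2, h3, h4, Or.inr (h5 ▸ htrans)⟩
  · rintro _ ⟨z, b, i, -, hG', rfl⟩
    exact (hG z _ hG').2.2.1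
  · rintro _ ⟨z, b, i, hb, hG', rfl⟩ howner q' hm
    refine ⟨z, b, i + 1, hb, hG', ?_⟩
    rw [guided_succ, hf.eve _ howner, hm]
    rfl
  · rintro _ ⟨z, b, i, hb, hG', rfl⟩ howner z' hz'
    have hnext : guided f z.1 b (i + 1) = z' := by
      rw [guided_succ, hf.adam _ howner z' hz']
      change (⟨_, _⟩ : Vertex Q) = z'
      rw [← hz'.1]
    exact ⟨z, b, i + 1, hb, by rw [hz'.1]; exact hG', hnext⟩
  · rintro _ ⟨z, b, i, hb, hG', rfl⟩ howner r₀ r₁ hm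
    have hchild : ∀ d, ((guided f z.1 b i).node, d) ∈ E →
        ∃ (z' : {z // Recurrent z}) (b' : Branch) (i' : ℕ), b' ∈ guidedPositive f A z'.1 ∧
          (guided f z.1 b i).node ++ [d] ∈ G z' ∧
            guided f z'.1 b' i' = ⟨(guided f z.1 b i).node ++ [d], bif d then r₁ else r₀⟩ := by
      intro d hd
      have hGd := (hG z _ hG').2.2.2 d hd
      -- The branch `b` may take the other son. It is replaced by a positive one through the
      -- required son, with the same play up to step `i`.
      obtain ⟨b', hb', hb'n⟩ := (hG z _ hGd).2.1
      obtain ⟨hcone, hlast⟩ := mem_cone_append.1 hb'n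
      have hguided : guided f z.1 b' i = guided f z.1 b i := by
        refine guided_congr f z.1 (Branch.pre_eq_pre_iff.1 ?_)
        rw [mem_cone.1 (mem_cone_guided f hb.1 i), mem_cone.1 hcone]
      refine ⟨z, b', i + 1, hb', hGd, ?_⟩
      rw [guided_succ, hguided, hlast, hf.eve _ howner, hm]
      rfl
    exact ⟨hchild false, hchild true⟩

end AltNonzero

theorem mainTheorem7 {Alph Q : Type*} [Finite Q] (A : AltNonzero.Automaton Alph Q)
    (hcomplete : A.Complete) (hnorm : A.Normalized) (hlimited : A.LimitedChoice)
    (hloop : A.NoLocalLoop) (t : AltNonzero.Node → Alph)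
    (σ : AltNonzero.Strategy A t AltNonzero.Player.eve) (hσ : AltNonzero.Positional σ) :
    AltNonzero.PositivelyWinning σ ↔
      ∃ (W : Set (AltNonzero.Vertex Q)) (E : Set (AltNonzero.Node × Bool)),
        AltNonzero.PositiveWitness σ W E := by
  constructor
  · exact AltNonzero.exists_positiveWitness hcomplete hlimited hloop hσ
  · rintro ⟨W, E, hW⟩
    exact AltNonzero.positivelyWinning_iff.2 fun τ b k hk =>
      hW.positiveBranches_pos hnorm hlimited hσ _ b k rfl hk
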